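/- Let $N\ge 2$, $\eta=2\pi/N$, and put $$\tilde b(\theta)=\frac{\theta}{\theta-i\eta},\quad \tilde c(\theta)=\frac{-i\eta}{\theta-i\eta},\quad \tilde d(\theta)=\frac{-i\eta}{i\pi-\theta},$$ $$\tilde\phi(\theta)=\Gamma\!\left(-\tfrac{\theta}{2\pi i}\right)\Gamma\!\left(1-\tfrac1N+\tfrac{\theta}{2\pi i}\right),\quad \tilde\chi(\omega)=\Gamma\!\left(\tfrac12+\tfrac{\omega}{2\pi i}\right)\Gamma\!\left(\tfrac12-\tfrac1N-\tfrac{\omega}{2\pi i}\right).$$ Particles are indices $\alpha\in\{1,\dots,N\}$, antiparticles are tuples $(\rho)=(\rho_1<\dots<\rho_{N-1})$ of such indices, and $\mathbf C_{(\rho)\beta}=\mathbf C^{\beta(\rho)}=\epsilon_{\rho_1\dots\rho_{N-1}\beta}$. Let $$\tilde S_{\alpha\beta}^{\delta\gamma}(\theta)=\delta_\alpha^\gamma\delta_\beta^\delta\,\tilde b(\theta)+\delta_\alpha^\delta\delta_\beta^\gamma\,\tilde c(\theta),\qquad \tilde S_{(\rho)\beta}^{\delta(\sigma)}(\theta)=\delta_{(\rho)}^{(\sigma)}\delta_\beta^\delta+\tilde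 d(\theta)\,\mathbf C^{\delta(\sigma)}\mathbf C_{(\rho)\beta}$$ be the normalised particle–particle and antiparticle–particle S-matrices, and $$\tilde T_{\alpha(\rho),s}^{\alpha',s(\rho')}(z,\omega,u)=\sum_{\gamma=1}^{N}\tilde S_{\alpha\gamma}^{\alpha's}(z-u)\,\tilde S_{(\rho)s}^{\gamma(\rho')}(\omega-u).$$ For one particle (rapidity $\theta=z_0$) and one antiparticle (rapidity $\omega$), with one integration variable $z_j$ at each level $j=1,\dots,N-1$, let $$\tilde h(\theta,\omega,\underline{\underline z})=\prod_{j=0}^{N-2}\tilde\phi(z_j-z_{j+1})\;\tilde\chi(\omega-z_{N-1}),\qquad \tilde\Phi_{\alpha\bar\delta}(\theta,\omega,\underline{\underline z})=\sum\prod_{j=0}^{N-2}\tilde T_{\alpha_j\bar\delta_j,\,j+1}^{\alpha_{j+1},\,j+1\,\bar\delta_{j+1}}(z_j,\omega,z_{j+1}),$$ where $(\alpha_0,\bar\delta_0)=(\alpha,\bar\delta)$, $(\alpha_{N-1},\bar\delta_{N-1})=(N,(1,\dots,N-1))$, and the sum is over all $\alpha_j\in\{j+1,\dots,N\}$ and all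 antiparticles $\bar\delta_j\supseteq\{1,\dots,j\}$, $1\le j\le N-2$. The variable $z_{j+1}$ is integrated along a contour $\mathcal C_{z_j,\omega}$ running from $-\infty$ to $+\infty$ which has the points $z_j-i\eta+2\pi ik$ and $\omega-i\pi+2\pi ik$ $(k\ge0)$ above it and the points $z_j-2\pi ik$ and $\omega+i\pi-i(j+1)\eta-2\pi ik$ $(k\ge0)$ below it; it is realised by a horizontal line avoiding these points, together with small counterclockwise circles around the points of the first kind that lie below the line and small clockwise circles around the points of the second kind that lie above the line. Such contours exist for all $z_j$ for which the two sets of points are disjoint. For every choice of them and all $\theta,\omega\in\mathbb C$ with $\theta-\omega\notin i\pi(2\mathbb Z+1)$ (in particular for all real rapidities), each contour that occurs separates the two sets of points, all iterated integrals converge absolutely, and the K-function with p-function $1$ vanishes identically: for all $\alpha$ and $\bar\delta$, $$K_{\alpha\bar\delta}(\theta,\omega)=\int_{\mathcal C_{\theta,\omega}}dz_1\int_{\mathcal C_{z_1,\omega}}dz_2\cdots\int_{\mathcal C_{z_{N-2},\omega}}dz_{N-1}\;\tilde h(\theta,\omega,\underline{\underline z})\,\tilde\Phi_{\alpha\bar\delta}(\theta,\omega,\underline{\underline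 z})=0 .$$ -/

import Mathlib

namespace NestedBethe

open Complex

noncomputable section

/-! ### Scalar functions -/

/-- The spacing `η = 2π/N`. -/
def eta (N : ℕ) : ℂ := 2 * Real.pi / N

/-- The amplitude `b̃(θ) = θ / (θ - iη)`. -/
def bTilde (N : ℕ) (θ : ℂ) : ℂ := θ / (θ - I * eta N)

/-- The amplitude `c̃(θ) = -iη / (θ - iη)`. -/
def cTilde (N : ℕ) (θ : ℂ) : ℂ := -(I * eta N) / (θ - I * eta N)

/-- The amplitude `d̃(θ) = -iη / (iπ - θ)`, equal to the quotient `c(iπ - θ) / b(iπ - θ)`. -/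
def dTilde (N : ℕ) (θ : ℂ) : ℂ := -(I * eta N) / (I * Real.pi - θ)

/-- `φ̃(θ) = Γ(-θ/(2πi)) Γ(1 - 1/N + θ/(2πi))`. -/
def phiTilde (N : ℕ) (θ : ℂ) : ℂ :=
  Gamma (-(θ / (2 * Real.pi * I))) * Gamma (1 - 1 / (N : ℂ) + θ / (2 * Real.pi * I))

/-- `χ̃(ω) = Γ(1/2 + ω/(2πi)) Γ(1/2 - 1/N - ω/(2πi))`. -/
def chiTilde (N : ℕ) (ω : ℂ) : ℂ :=
  Gamma (1 / 2 + ω / (2 * Real.pi * I)) *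
    Gamma (1 / 2 - 1 / (N : ℂ) - ω / (2 * Real.pi * I))

/-! ### Particles and antiparticles

A particle is an index `α : Fin N` (the value `k` stands for the index `k + 1`).
An antiparticle is a bound state `(ρ₁ … ρ_{N-1})` with `ρ₁ < … < ρ_{N-1}`. -/

/-- Antiparticles: strictly increasing `(N-1)`-tuples of particle indices. -/
abbrev Antiparticle (N : ℕ) : Type := Fin (N - 1) ↪o Fin N

/-- The totally antisymmetric symbol `ε_{f(1) … f(N)}`. -/
def levi {N : ℕ} (f : Fin N → Fin N) : ℂ :=
  open Classical in
  if h : Function.Bijective f then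
    ((Equiv.Perm.sign (Equiv.ofBijective f h) : ℤ) : ℂ) else 0

/-- The charge conjugation matrix with the antiparticle written first,
`C_{(ρ)β} = C^{β(ρ)} = ε_{ρ₁ … ρ_{N-1} β}`. -/
def charge {N : ℕ} (ρ : Antiparticle N) (β : Fin N) : ℂ :=
  levi fun i : Fin N => if h : i.val < N - 1 then ρ ⟨i.val, h⟩ else β

/-! ### S-matrices and monodromy matrices -/

/-- Particle-particle S-matrix normalised by `a(θ)`:
`S̃_{αβ}^{δγ}(θ) = δ_α^γ δ_β^δ b̃(θ) + δ_α^δ δ_β^γ c̃(θ)`; arguments in the order `α β δ γ`. -/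
def sTilde (N : ℕ) (θ : ℂ) (α β δ γ : Fin N) : ℂ :=
  (if α = γ ∧ β = δ then bTilde N θ else 0) + (if α = δ ∧ β = γ then cTilde N θ else 0)

/-- Antiparticle-particle S-matrix normalised by `(-1)^(N-1) b(iπ - θ)`:
`S̃_{ρβ}^{δσ}(θ) = δ_ρ^σ δ_β^δ + d̃(θ) C^{δ(σ)} C_{(ρ)β}`; arguments in the order `ρ β δ σ`. -/
def sBarTilde (N : ℕ) (θ : ℂ) (ρ : Antiparticle N) (β δ : Fin N) (σ : Antiparticle N) : ℂ :=
  open Classical in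
  (if ρ = σ ∧ β = δ then 1 else 0) + dTilde N θ * charge σ δ * charge ρ β

/-- The entry of the monodromy matrix of one particle (rapidity `z`) and one antiparticle
(rapidity `ω`), crossed from right to left by an auxiliary line (rapidity `u`) that enters
with index `s` and leaves with index `α'`, while the particle goes from `α` to `s` and the
antiparticle goes from `ρ` to `ρ'`:
`T_{α ρ, s}^{α', s ρ'} = ∑_γ S̃_{αγ}^{α's}(z - u) S̃_{ρs}^{γρ'}(ω - u)`. -/
def monodromy (N : ℕ) (s : Fin N) (z ω u : ℂ) (α : Fin N) (ρ : Antiparticle N)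
    (α' : Fin N) (ρ' : Antiparticle N) : ℂ :=
  ∑ γ : Fin N, sTilde N (z - u) α γ α' s * sBarTilde N (ω - u) ρ s γ ρ'

/-! ### The complete Bethe ansatz state

The rapidities are listed in one sequence `z`, with `z 0 = θ` the rapidity of the particle and
`z 1, …, z (N-1)` the integration variables, one for each level. -/

/-- Particle indices that occur above level `j`: those different from the first `j` ones. -/
def particleRange (N j : ℕ) : Finset (Fin N) :=
  Finset.univ.filter fun α => j ≤ α.val

/-- Antiparticles that occur above level `j`: those that contain the first `j` indices. -/
def antiparticleRange (N j : ℕ) : Finset (Antiparticle N) :=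
  open Classical in
  Finset.univ.filter fun ρ => ∀ i : Fin N, i.val < j → i ∈ Set.range ρ

/-- The product of the Bethe states of the `k` levels `j, …, j + k - 1`, summed over the
intermediate indices; the reference state of level `j` has the `(j+1)`-st index, and the final
state is `(N, (1, …, N-1))`. -/
def betheFrom (N : ℕ) (ω : ℂ) (z : ℕ → ℂ) : ℕ → ℕ → Fin N → Antiparticle N → ℂ
  | 0, _, α, ρ =>
    open Classical in
    if α.val = N - 1 ∧ ∀ i, (ρ i).val = i.val then 1 else 0
  | k + 1, j, α, ρ =>
    if hj : j < N then
      ∑ α' ∈ particleRange N (j + 1), ∑ ρ' ∈ antiparticleRange N (j + 1),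
        betheFrom N ω z k (j + 1) α' ρ' *
          monodromy N ⟨j, hj⟩ (z j) ω (z (j + 1)) α ρ α' ρ'
    else 0

/-- The complete Bethe ansatz state `Φ̃_{αδ̄}(θ, ω, z)`: all levels `0, …, N - 2`. -/
def betheState (N : ℕ) (ω : ℂ) (z : ℕ → ℂ) (α : Fin N) (δ : Antiparticle N) : ℂ :=
  betheFrom N ω z (N - 1) 0 α δ

/-- The complete h-function `h̃(θ, ω, z) = ∏_{j=0}^{N-2} φ̃(z_j - z_{j+1}) · χ̃(ω - z_{N-1})`. -/
def hTilde (N : ℕ) (ω : ℂ) (z : ℕ → ℂ) : ℂ :=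
  (∏ j ∈ Finset.range (N - 1), phiTilde N (z j - z (j + 1))) * chiTilde N (ω - z (N - 1))

/-! ### Integration contours -/

/-- A contour made of the line `Im u = height` run from left to right, circles run
counterclockwise and circles run clockwise, all circles with the same radius. -/
structure Contour where
  height : ℝ
  ccw : Finset ℂ
  cw : Finset ℂ
  radius : ℝ

namespace Contour

/-- The integral of a function along a contour. -/
def integral (C : Contour) (f : ℂ → ℂ) : ℂ :=
  (∫ t : ℝ, f (t + C.height * I)) + (∑ p ∈ C.ccw, circleIntegral f p C.radius) -
    ∑ p ∈ C.cw, circleIntegral f p C.radius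

/-- Absolute convergence of the integral along a contour. -/
def Integrable (C : Contour) (f : ℂ → ℂ) : Prop :=
  MeasureTheory.Integrable (fun t : ℝ => f (t + C.height * I)) ∧
    ∀ p ∈ C.ccw ∪ C.cw, CircleIntegrable f p C.radius

/-- The points of a contour. -/
def points (C : Contour) : Set ℂ :=
  {u | u.im = C.height} ∪ {u | ∃ p ∈ C.ccw ∪ C.cw, ‖u - p‖ = C.radius}

/-- The contour runs from left to right with the points of `U` above it (on its left) and the
points of `D` below it (on its right): the line avoids all these points, the points of `U` below
the line are encircled counterclockwise, the points of `D` above the line are encircled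
clockwise, and every circle is so small that it surrounds no other of these points. -/
structure Separates (C : Contour) (U D : Set ℂ) : Prop where
  disjoint : Disjoint U D
  line : ∀ p ∈ U ∪ D, p.im ≠ C.height
  mem_ccw : ∀ p, p ∈ C.ccw ↔ p ∈ U ∧ p.im < C.height
  mem_cw : ∀ p, p ∈ C.cw ↔ p ∈ D ∧ C.height < p.im
  radius_pos : 0 < C.radius
  radius_lt : ∀ p ∈ U ∪ D, ∀ q ∈ U ∪ D, p ≠ q → C.radius < dist p q

end Contour

/-- The poles in `u = z_{j+1}` above the contour of level `j`, for `z = z_j`: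
`z - iη + 2πik` and `ω - iπ + 2πik` with `k ≥ 0`. -/
def polesAbove (N : ℕ) (ω z : ℂ) : Set ℂ :=
  {u | ∃ k : ℕ, u = z - I * eta N + 2 * Real.pi * I * k} ∪
    {u | ∃ k : ℕ, u = ω - I * Real.pi + 2 * Real.pi * I * k}

/-- The poles in `u = z_{j+1}` below the contour of level `j`, for `z = z_j`:
`z - 2πik` and `ω + iπ - i(j+1)η - 2πik` with `k ≥ 0`. For `j = N - 2` the second family consists
of poles of `χ̃(ω - u)`; for `j < N - 2` these are the points `u` at which a pole above and a pole
below the contour of the next level collide. -/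
def polesBelow (N : ℕ) (ω : ℂ) (j : ℕ) (z : ℂ) : Set ℂ :=
  {u | ∃ k : ℕ, u = z - 2 * Real.pi * I * k} ∪
    {u | ∃ k : ℕ, u = ω + I * Real.pi - I * eta N * (j + 1) - 2 * Real.pi * I * k}

/-- A choice of integration contours `𝒞_{z,ω}` for all levels `j = 0, …, N - 2`: for every `z` for
which the two sets of poles are disjoint, `C j z` separates them. -/
def IsContourSystem (N : ℕ) (ω : ℂ) (C : ℕ → ℂ → Contour) : Prop :=
  ∀ j < N - 1, ∀ z : ℂ, Disjoint (polesAbove N ω z) (polesBelow N ω j z) →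
    (C j z).Separates (polesAbove N ω z) (polesBelow N ω j z)

/-! ### The nested integral -/

/-- The iterated integral of `F` over the `k` variables `z (j+1), …, z (j+k)`, where the variable
`z (i+1)` runs through the contour `C i (z i)`. -/
def nestedIntegral (C : ℕ → ℂ → Contour) (F : (ℕ → ℂ) → ℂ) : ℕ → ℕ → (ℕ → ℂ) → ℂ
  | 0, _, z => F z
  | k + 1, j, z => (C j (z j)).integral fun u =>
      nestedIntegral C F k (j + 1) (Function.update z (j + 1) u)

/-- The iterated integral is well defined: all contours that occur in it separate the poles,
and all integrals that occur in it converge absolutely. -/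
def NestedWellDefined (N : ℕ) (ω : ℂ) (C : ℕ → ℂ → Contour) (F : (ℕ → ℂ) → ℂ) :
    ℕ → ℕ → (ℕ → ℂ) → Prop
  | 0, _, _ => True
  | k + 1, j, z =>
      (C j (z j)).Separates (polesAbove N ω (z j)) (polesBelow N ω j (z j)) ∧
      ((C j (z j)).Integrable fun u =>
        nestedIntegral C F k (j + 1) (Function.update z (j + 1) u)) ∧
      ∀ u ∈ (C j (z j)).points,
        NestedWellDefined N ω C F k (j + 1) (Function.update z (j + 1) u)

/-- The integrand `h̃(θ, ω, z) Φ̃_{αδ̄}(θ, ω, z)`, with p-function equal to `1`. -/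
def integrand (N : ℕ) (ω : ℂ) (α : Fin N) (δ : Antiparticle N) (z : ℕ → ℂ) : ℂ :=
  hTilde N ω z * betheState N ω z α δ

/-- The K-function `K_{αδ̄}(θ, ω)` of one particle and one antiparticle, with p-function `1`. -/
def kFunction (N : ℕ) (C : ℕ → ℂ → Contour) (θ ω : ℂ) (α : Fin N) (δ : Antiparticle N) : ℂ :=
  nestedIntegral C (integrand N ω α δ) (N - 1) 0 fun _ => θ

end

end NestedBethe

/-! The nested Bethe state collapses to a scalar. Each level keeps its antiparticle sums trivial: if
the particle differs from the reference index of the level, it passes through with `cTilde`; if it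
equals that index, it annihilates against the antiparticle and a new pair is created, with weight
`bTilde * dTilde`, and the sum over all pairs telescopes. Hence the state with external particle `α`
is `charge δ α` times a product of one weight per level (`betheFrom_eq`, `sum_prod_levelWeight`).

The multiple integral is then evaluated from the inside out. In the variable s = u/(2πi), the
integrand of level j is a combination of at most two integrands of Barnes' first lemma
(`levelIntegrand_eq`). Integration reproduces the factor of ω - z with j + 1 replaced by j, times a
constant (`level_integral`). In both Barnes integrals the four parameters sum to j/N, so the
constant carries 1/Γ(j/N). At the outermost level this is 1/Γ(0) = 0, which makes the K-function
vanish for every α and δ.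

Barnes' lemma is needed for arbitrary separating contours. When all pairwise sums of a lower and an
upper parameter have positive real part, a straight line separates the poles and the lemma is a
Parseval identity for Fourier transforms of Beta integrands. A contiguous relation, obtained by
translating s by 1, extends it to all parameters with disjoint pole families (`barnesLemma`).
Independence of the contour is the residue theorem in a horizontal strip, with convergence from the
rapid decay of Γ on vertical lines. Since each inner integral has a closed form on the outer
contour, no regularity of the choice of contours in z is required. -/

namespace NestedBethe

open Complex Filter Topology MeasureTheory Set

/-! ### Residues -/

/-- The integral of `f` over all small circles around `p` equals `v`. -/
def HasResidue (f : ℂ → ℂ) (p v : ℂ) : Prop :=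
  ∀ᶠ r in 𝓝[>] (0 : ℝ), circleIntegral f p r = v

/-- The integral of `f` over small circles around `p`. -/
noncomputable def residue (f : ℂ → ℂ) (p : ℂ) : ℂ :=
  limUnder (𝓝[>] (0 : ℝ)) fun r => circleIntegral f p r

theorem HasResidue.residue_eq {f : ℂ → ℂ} {p v : ℂ} (h : HasResidue f p v) :
    residue f p = v :=
  (tendsto_const_nhds.congr' (h.mono fun _ hr => hr.symm)).limUnder_eq

/-- A property that holds near `p` except at `p` holds on all small circles around `p`. -/
theorem eventually_sphere {P : ℂ → Prop} {p : ℂ} (h : ∀ᶠ z in 𝓝[≠] p, P z) :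
    ∀ᶠ r in 𝓝[>] (0 : ℝ), ∀ z ∈ Metric.sphere p r, P z := by
  rw [eventually_nhdsWithin_iff, Metric.eventually_nhds_iff] at h
  obtain ⟨ε, hε, h⟩ := h
  filter_upwards [Ioo_mem_nhdsGT hε] with r hr z hz
  refine h ?_ ?_
  · rw [Metric.mem_sphere.1 hz]; exact hr.2
  · rintro rfl
    simp at hz
    exact hr.1.ne hz

theorem HasResidue.congr {f g : ℂ → ℂ} {p v : ℂ} (h : HasResidue f p v)
    (hfg : f =ᶠ[𝓝[≠] p] g) : HasResidue g p v := by
  filter_upwards [h, eventually_sphere hfg, self_mem_nhdsWithin] with r hr hs h0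
  rw [← hr]
  exact (circleIntegral.integral_congr (le_of_lt h0) hs).symm

theorem eventually_circleIntegrable {f : ℂ → ℂ} {p : ℂ} (hf : MeromorphicAt f p) :
    ∀ᶠ r in 𝓝[>] (0 : ℝ), CircleIntegrable f p r := by
  filter_upwards [eventually_sphere hf.eventually_analyticAt, self_mem_nhdsWithin] with r hr h0
  refine ContinuousOn.circleIntegrable (le_of_lt h0) fun z hz => ?_
  exact (hr z hz).continuousAt.continuousWithinAt

theorem HasResidue.add {f g : ℂ → ℂ} {p v w : ℂ} (h : HasResidue f p v) (h' : HasResidue g p w)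
    (hf : MeromorphicAt f p) (hg : MeromorphicAt g p) :
    HasResidue (fun z => f z + g z) p (v + w) := by
  filter_upwards [h, h', eventually_circleIntegrable hf, eventually_circleIntegrable hg]
    with r h1 h2 h3 h4
  rw [circleIntegral.integral_add h3 h4, h1, h2]

theorem HasResidue.const_mul {f : ℂ → ℂ} {p v : ℂ} (h : HasResidue f p v) (c : ℂ) :
    HasResidue (fun z => c * f z) p (c * v) := by
  filter_upwards [h] with r h1
  rw [circleIntegral.integral_const_mul, h1]

theorem hasResidue_of_analyticAt {f : ℂ → ℂ} {p : ℂ} (hf : AnalyticAt ℂ f p) :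
    HasResidue f p 0 := by
  have := hf.eventually_analyticAt
  rw [Metric.eventually_nhds_iff] at this
  obtain ⟨ε, hε, h⟩ := this
  filter_upwards [Ioo_mem_nhdsGT hε] with r hr
  refine circleIntegral_eq_zero_of_differentiable_on_off_countable hr.1.le countable_empty
    (fun z hz => ?_) (fun z hz => ?_)
  · exact (h ((Metric.mem_closedBall.1 hz).trans_lt hr.2)).continuousAt.continuousWithinAt
  · exact (h ((Metric.mem_ball.1 hz.1).trans hr.2)).differentiableAt

theorem hasResidue_inv (p : ℂ) : HasResidue (fun z => (z - p)⁻¹) p (2 * Real.pi * I) := by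
  filter_upwards [self_mem_nhdsWithin] with r hr
  exact circleIntegral.integral_sub_center_inv p (ne_of_gt hr)

theorem hasResidue_inv_pow (p : ℂ) (k : ℕ) :
    HasResidue (fun z => (z - p)⁻¹ ^ (k + 2)) p 0 := by
  filter_upwards with r
  have := circleIntegral.integral_sub_zpow_of_ne (n := -((k : ℤ) + 2)) (by omega) p p r
  rw [← this]
  congr 1
  ext z
  rw [inv_pow, zpow_neg]
  norm_cast

theorem analyticAt_inv_pow {p z : ℂ} (h : z ≠ p) (k : ℕ) :
    AnalyticAt ℂ (fun z => (z - p)⁻¹ ^ k) z := by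
  have : z - p ≠ 0 := sub_ne_zero.2 h
  fun_prop (disch := assumption)

theorem meromorphicAt_inv_pow (p z : ℂ) (k : ℕ) :
    MeromorphicAt (fun z => (z - p)⁻¹ ^ k) z := by
  have : MeromorphicAt (fun z => z - p) z := by fun_prop
  exact this.inv.pow k

/-- The principal part of a meromorphic function. -/
theorem exists_principalPart {f : ℂ → ℂ} {p : ℂ} (hf : MeromorphicAt f p) :
    ∃ (n : ℕ) (a : ℕ → ℂ) (r : ℂ → ℂ), AnalyticAt ℂ r p ∧
      f =ᶠ[𝓝[≠] p] fun z => (∑ k ∈ Finset.range (n + 1), a k * (z - p)⁻¹ ^ (k + 1)) + r z := by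
  obtain ⟨n, hn⟩ := hf
  -- One order of the pole is removed at a time by g(z) = g(p) + (z - p) · `dslope g p z`, whose
  -- slope is again analytic at p.
  have key : ∀ (n : ℕ) (g : ℂ → ℂ), AnalyticAt ℂ g p →
      ∃ (a : ℕ → ℂ) (r : ℂ → ℂ), AnalyticAt ℂ r p ∧
        ∀ᶠ z in 𝓝[≠] p, (z - p)⁻¹ ^ n * g z =
          (∑ k ∈ Finset.range n, a k * (z - p)⁻¹ ^ (k + 1)) + r z := by
    intro n
    induction n with
    | zero => exact fun g hg => ⟨0, g, hg, by simp⟩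
    | succ n ih =>
      intro g hg
      have hd : AnalyticAt ℂ (dslope g p) p := by
        obtain ⟨q, hq⟩ := hg
        exact ⟨_, hq.has_fpower_series_dslope_fslope⟩
      obtain ⟨a, r, hr, h⟩ := ih _ hd
      refine ⟨Function.update a n (g p), r, hr, ?_⟩
      filter_upwards [h, self_mem_nhdsWithin] with z hz hne
      have hzp : z - p ≠ 0 := sub_ne_zero.2 hne
      rw [Finset.sum_range_succ, Function.update_self, Finset.sum_congr rfl (fun k hk => by
        rw [Function.update_of_ne (Finset.mem_range.1 hk).ne])]
      rw [add_right_comm, ← hz, dslope_of_ne _ hne, slope_def_field, div_eq_inv_mul, pow_succ]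
      ring
  obtain ⟨a, r, hr, h⟩ := key n _ hn
  -- Padding with a zero coefficient makes the sum nonempty, so that `a 0`, the coefficient that
  -- gives the residue, always occurs in it.
  refine ⟨n, Function.update a n 0, r, hr, ?_⟩
  filter_upwards [h, self_mem_nhdsWithin] with z hz hne
  have hzp : z - p ≠ 0 := sub_ne_zero.2 hne
  rw [Finset.sum_range_succ, Function.update_self, Finset.sum_congr rfl (fun k hk => by
    rw [Function.update_of_ne (Finset.mem_range.1 hk).ne]), zero_mul, add_zero, ← hz]
  simp only [smul_eq_mul, inv_pow]
  field_simp

theorem meromorphicAt_sum_inv_pow (p z : ℂ) (n : ℕ) (a : ℕ → ℂ) :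
    MeromorphicAt (fun z => ∑ k ∈ Finset.range n, a k * (z - p)⁻¹ ^ (k + 1)) z :=
  MeromorphicAt.fun_sum fun _ _ => (MeromorphicAt.const _ _).mul (meromorphicAt_inv_pow p z _)

theorem hasResidue_sum_inv_pow (p : ℂ) (n : ℕ) (a : ℕ → ℂ) :
    HasResidue (fun z => ∑ k ∈ Finset.range (n + 1), a k * (z - p)⁻¹ ^ (k + 1)) p
      (a 0 * (2 * Real.pi * I)) := by
  induction n with
  | zero => simpa using (hasResidue_inv p).const_mul (a 0)
  | succ n ih =>
    simp only [Finset.sum_range_succ _ (n + 1)]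
    simpa using ih.add ((hasResidue_inv_pow p n).const_mul (a (n + 1)))
      (meromorphicAt_sum_inv_pow p p _ a)
      ((MeromorphicAt.const _ _).mul (meromorphicAt_inv_pow p p _))

theorem exists_hasResidue {f : ℂ → ℂ} {p : ℂ} (hf : MeromorphicAt f p) :
    ∃ v, HasResidue f p v := by
  obtain ⟨n, a, r, hr, h⟩ := exists_principalPart hf
  exact ⟨_, ((hasResidue_sum_inv_pow p n a).add (hasResidue_of_analyticAt hr)
    (meromorphicAt_sum_inv_pow p p _ a) hr.meromorphicAt).congr h.symm⟩

theorem hasResidue_residue {f : ℂ → ℂ} {p : ℂ} (hf : MeromorphicAt f p) :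
    HasResidue f p (residue f p) := by
  obtain ⟨v, hv⟩ := exists_hasResidue hf
  rwa [hv.residue_eq]

/-- A circle around `p` that surrounds no other singularity computes the residue. -/
theorem circleIntegral_eq_residue {f : ℂ → ℂ} {p : ℂ} {R : ℝ} (hR : 0 < R)
    (hf : ∀ z ∈ Metric.closedBall p R, z ≠ p → AnalyticAt ℂ f z) (hp : MeromorphicAt f p) :
    circleIntegral f p R = residue f p := by
  have h := hasResidue_residue hp
  obtain ⟨r, hr, h0, h1⟩ := (h.and (Ioo_mem_nhdsGT hR)).exists
  rw [← hr]
  refine circleIntegral_eq_of_differentiable_on_annulus_off_countable h0 h1.le countable_empty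
    (fun z hz => ?_) (fun z hz => ?_)
  · refine (hf z hz.1 ?_).continuousAt.continuousWithinAt
    rintro rfl
    exact hz.2 (Metric.mem_ball_self h0)
  · refine (hf z (Metric.ball_subset_closedBall hz.1.1) ?_).differentiableAt
    rintro rfl
    exact hz.1.2 (Metric.mem_closedBall_self h0.le)

/-! ### Decay in horizontal strips -/

/-- Quadratic decay in every horizontal strip. -/
def StripDecay (f : ℂ → ℂ) : Prop :=
  ∀ a b : ℝ, ∃ C T : ℝ, ∀ z : ℂ, a ≤ z.im → z.im ≤ b → T ≤ |z.re| → ‖f z‖ ≤ C / z.re ^ 2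

theorem StripDecay.add {f g : ℂ → ℂ} (hf : StripDecay f) (hg : StripDecay g) :
    StripDecay fun z => f z + g z := by
  intro a b
  obtain ⟨C, T, h⟩ := hf a b
  obtain ⟨C', T', h'⟩ := hg a b
  refine ⟨C + C', max T T', fun z h1 h2 h3 => (norm_add_le _ _).trans ?_⟩
  rw [add_div]
  exact add_le_add (h z h1 h2 ((le_max_left _ _).trans h3))
    (h' z h1 h2 ((le_max_right _ _).trans h3))

theorem StripDecay.const_mul {f : ℂ → ℂ} (hf : StripDecay f) (c : ℂ) :
    StripDecay fun z => c * f z := by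
  intro a b
  obtain ⟨C, T, h⟩ := hf a b
  refine ⟨‖c‖ * C, T, fun z h1 h2 h3 => ?_⟩
  rw [norm_mul, mul_div_assoc]
  exact mul_le_mul_of_nonneg_left (h z h1 h2 h3) (norm_nonneg _)

theorem stripDecay_zero : StripDecay fun _ => 0 := fun a b => ⟨0, 0, by simp⟩

theorem StripDecay.sum {ι : Type*} {f : ι → ℂ → ℂ} (s : Finset ι) (hf : ∀ i, StripDecay (f i)) :
    StripDecay fun z => ∑ i ∈ s, f i z := by
  classical
  induction s using Finset.induction_on with
  | empty => simpa using stripDecay_zero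
  | insert i s hi ih => simpa only [Finset.sum_insert hi] using (hf i).add ih

theorem StripDecay.congr {f g : ℂ → ℂ} (hf : StripDecay f) (p : ℂ)
    (h : ∀ z, z ≠ p → g z = f z) : StripDecay g := by
  intro a b
  obtain ⟨C, T, H⟩ := hf a b
  refine ⟨C, max T (|p.re| + 1), fun z h1 h2 h3 => ?_⟩
  rw [h]
  · exact H z h1 h2 ((le_max_left _ _).trans h3)
  · rintro rfl
    linarith [(le_max_right T (|z.re| + 1)).trans h3]

theorem norm_inv_sub_le {p z : ℂ} (h : 2 * |p.re| + 1 ≤ |z.re|) : ‖(z - p)⁻¹‖ ≤ 2 / |z.re| := by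
  have h1 : |z.re| / 2 ≤ ‖z - p‖ := by
    have := (abs_sub_abs_le_abs_sub z.re p.re).trans (by simpa using abs_re_le_norm (z - p))
    linarith [abs_nonneg p.re]
  have h0 : 0 < |z.re| := by linarith [abs_nonneg p.re]
  rw [norm_inv]
  calc ‖z - p‖⁻¹ ≤ (|z.re| / 2)⁻¹ := inv_anti₀ (by linarith) h1
    _ = 2 / |z.re| := by rw [inv_div]

theorem stripDecay_inv_mul_inv (p q : ℂ) : StripDecay fun z => (z - p)⁻¹ * (z - q)⁻¹ := by
  intro a b
  refine ⟨4, 2 * |p.re| + 2 * |q.re| + 1, fun z _ _ h => ?_⟩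
  have hp := norm_inv_sub_le (p := p) (z := z) (by linarith [abs_nonneg q.re])
  have hq := norm_inv_sub_le (p := q) (z := z) (by linarith [abs_nonneg p.re])
  rw [norm_mul]
  calc _ ≤ 2 / |z.re| * (2 / |z.re|) := by gcongr
    _ = 4 / z.re ^ 2 := by rw [div_mul_div_comm, ← sq, ← sq, sq_abs]; norm_num

theorem stripDecay_inv_pow (p : ℂ) (k : ℕ) : StripDecay fun z => (z - p)⁻¹ ^ (k + 2) := by
  intro a b
  refine ⟨4, 2 * |p.re| + 2, fun z _ _ h => ?_⟩
  have hp := norm_inv_sub_le (p := p) (z := z) (by linarith)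
  have h1 : ‖(z - p)⁻¹‖ ≤ 1 := by
    refine hp.trans ?_
    rw [div_le_one] <;> linarith [abs_nonneg p.re]
  rw [norm_pow, pow_add]
  calc _ ≤ 1 * (2 / |z.re|) ^ 2 := by gcongr; exact pow_le_one₀ (norm_nonneg _) h1
    _ = 4 / z.re ^ 2 := by rw [div_pow, sq_abs]; norm_num

theorem integrable_line {f : ℂ → ℂ} {h : ℝ} (hf : StripDecay f)
    (hc : ∀ z : ℂ, z.im = h → ContinuousAt f z) :
    Integrable fun t : ℝ => f (t + h * I) := by
  have hcont : Continuous fun t : ℝ => f (t + h * I) := by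
    rw [continuous_iff_continuousAt]
    intro t
    exact (hc (t + h * I) (by simp)).comp (f := fun t : ℝ => (t : ℂ) + h * I)
      (by fun_prop : Continuous fun t : ℝ => (t : ℂ) + h * I).continuousAt
  obtain ⟨C, T, H⟩ := hf h h
  refine hcont.locallyIntegrable.integrable_of_isBigO_cocompact (g := fun t : ℝ => (1 + t ^ 2)⁻¹)
    ?_ (integrable_inv_one_add_sq.integrableAtFilter _)
  -- For |t| ≥ 1 one has 1 + t² ≤ 2t², hence the factor 2.
  refine Asymptotics.IsBigO.of_bound (2 * |C|) ?_
  have : ∀ᶠ t : ℝ in cocompact ℝ, max T 1 ≤ |t| := by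
    simpa using (tendsto_norm_cocompact_atTop (E := ℝ)).eventually_ge_atTop (max T 1)
  filter_upwards [this] with t ht
  have h1 : 1 ≤ |t| := (le_max_right _ _).trans ht
  have h2 := H (t + h * I) (by simp) (by simp) (by simpa using (le_max_left _ _).trans ht)
  have h3 : 1 ≤ t ^ 2 := by rw [← sq_abs]; exact one_le_pow₀ h1
  refine h2.trans ?_
  rw [Real.norm_of_nonneg (by positivity)]
  simp only [add_re, ofReal_re, mul_re, I_re, mul_zero, ofReal_im, I_im, mul_one,
    add_zero, sub_self]
  rw [← div_eq_mul_inv, div_le_div_iff₀ (by positivity) (by positivity)]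
  nlinarith [le_abs_self C, abs_nonneg C]

/-- Cauchy's theorem on the rectangle [-R, R] × [a, b]: the vertical sides are O(R⁻²) and disappear
as R → ∞. -/
theorem integral_line_eq_of_analyticAt {f : ℂ → ℂ} {a b : ℝ} (hab : a ≤ b) (hf : StripDecay f)
    (hA : ∀ z : ℂ, a ≤ z.im → z.im ≤ b → AnalyticAt ℂ f z) :
    ∫ t : ℝ, f (t + a * I) = ∫ t : ℝ, f (t + b * I) := by
  have hia := integrable_line (h := a) hf fun z hz => (hA z hz.ge (hz.trans_le hab)).continuousAt
  have hib := integrable_line (h := b) hf fun z hz => (hA z (hab.trans hz.ge) hz.le).continuousAt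
  have hla := intervalIntegral_tendsto_integral hia tendsto_neg_atTop_atBot tendsto_id
  have hlb := intervalIntegral_tendsto_integral hib tendsto_neg_atTop_atBot tendsto_id
  obtain ⟨C, T, H⟩ := hf a b
  have hv : ∀ σ : ℝ, |σ| = 1 →
      Tendsto (fun R : ℝ => I • ∫ y : ℝ in a..b, f ((σ * R : ℝ) + y * I)) atTop (𝓝 0) := by
    intro σ hσ
    rw [tendsto_zero_iff_norm_tendsto_zero]
    have hlim : Tendsto (fun R : ℝ => C / R ^ 2 * |b - a|) atTop (𝓝 0) := by
      have : Tendsto (fun R : ℝ => C / R ^ 2) atTop (𝓝 0) :=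
        tendsto_const_nhds.div_atTop (tendsto_pow_atTop (by norm_num))
      simpa using this.mul_const |b - a|
    refine squeeze_zero' (Eventually.of_forall fun _ => norm_nonneg _) ?_ hlim
    filter_upwards [eventually_ge_atTop T, eventually_ge_atTop 0] with R hR hR0
    rw [norm_smul, norm_I, one_mul]
    refine intervalIntegral.norm_integral_le_of_norm_le_const fun y hy => ?_
    rw [uIoc_of_le hab] at hy
    have := H ((σ * R : ℝ) + y * I) (by simpa using hy.1.le) (by simpa using hy.2)
      (by simpa [abs_mul, hσ] using hR.trans (le_abs_self R))
    refine this.trans (le_of_eq ?_)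
    have h2 : σ ^ 2 = 1 := by rw [← sq_abs, hσ, one_pow]
    simp [mul_pow, h2]
  have hrect : ∀ R : ℝ, ((∫ x : ℝ in (-R)..R, f (x + a * I)) - ∫ x : ℝ in (-R)..R, f (x + b * I)) +
      I • (∫ y : ℝ in a..b, f ((1 * R : ℝ) + y * I)) -
      I • (∫ y : ℝ in a..b, f ((-1 * R : ℝ) + y * I)) = 0 := by
    intro R
    have := integral_boundary_rect_eq_zero_of_differentiableOn f (-R + a * I) (R + b * I) (by
      intro z hz
      have h2 : z.im ∈ uIcc a b := by
        have := hz.2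
        simpa using this
      rw [uIcc_of_le hab] at h2
      exact (hA z h2.1 h2.2).differentiableAt.differentiableWithinAt)
    simpa using this
  have := ((hla.sub hlb).add (hv 1 (by simp))).sub (hv (-1) (by simp))
  simp only [id] at this
  have h0 := tendsto_nhds_unique this (tendsto_const_nhds.congr fun R => (hrect R).symm)
  rw [add_zero, sub_zero] at h0
  exact sub_eq_zero.1 h0

/-! ### Shifting a horizontal line across singularities -/

/-- Functions with a single pole at `p` in a half plane that does not contain `q`; they decay
quadratically in horizontal strips. -/
noncomputable def polarKernel (p q : ℂ) : ℕ → ℂ → ℂ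
  | 0, z => (p - q) * ((z - p)⁻¹ * (z - q)⁻¹)
  | k + 1, z => (z - p)⁻¹ ^ (k + 2)

/-- A simple pole alone decays only like 1/z, which is not integrable on a line; subtracting a
second simple pole at q restores quadratic decay. -/
theorem polarKernel_zero_eq {p q z : ℂ} (hp : z ≠ p) (hq : z ≠ q) :
    polarKernel p q 0 z = (z - p)⁻¹ - (z - q)⁻¹ := by
  have h1 := sub_ne_zero.2 hp
  have h2 := sub_ne_zero.2 hq
  simp only [polarKernel]
  field_simp
  ring

theorem stripDecay_polarKernel (p q : ℂ) (k : ℕ) : StripDecay (polarKernel p q k) := by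
  cases k with
  | zero => exact (stripDecay_inv_mul_inv p q).const_mul _
  | succ k => exact stripDecay_inv_pow p k

theorem analyticAt_polarKernel {p q z : ℂ} (hp : z ≠ p) (hq : z ≠ q) (k : ℕ) :
    AnalyticAt ℂ (polarKernel p q k) z := by
  have h1 := sub_ne_zero.2 hp
  have h2 := sub_ne_zero.2 hq
  cases k with
  | zero => unfold polarKernel; fun_prop (disch := assumption)
  | succ k => exact analyticAt_inv_pow hp (k + 2)

theorem integral_div_sq_add_sq {α : ℝ} (hα : α ≠ 0) :
    ∫ t : ℝ, α / (t ^ 2 + α ^ 2) = |α| / α * Real.pi := by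
  have h : ∀ t : ℝ, α / (t ^ 2 + α ^ 2) = α⁻¹ * (1 + (t / α) ^ 2)⁻¹ := by
    intro t
    have : t ^ 2 + α ^ 2 ≠ 0 := by positivity
    have h' : 1 + (t / α) ^ 2 ≠ 0 := by positivity
    field_simp
    ring
  simp_rw [h]
  rw [integral_const_mul, Measure.integral_comp_div (fun t : ℝ => (1 + t ^ 2)⁻¹),
    integral_univ_inv_one_add_sq, smul_eq_mul]
  ring

/-- The integral of a non-integrable function is 0 by convention, whereas this integral is ±π. -/
theorem integrable_div_sq_add_sq {α : ℝ} (hα : α ≠ 0) :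
    Integrable fun t : ℝ => α / (t ^ 2 + α ^ 2) := by
  by_contra h
  have := integral_div_sq_add_sq hα
  rw [integral_undef h] at this
  have h2 : |α| / α * Real.pi ≠ 0 := by positivity
  exact h2 this.symm

/-- Since p and q have the same real part, reflecting the line in that abscissa cancels the odd part
of both terms. What remains is a difference of Lorentzians, each contributing ±π according to the
side of the line on which its pole lies. -/
theorem integral_polarKernel_zero {p q : ℂ} (hpq : p.re = q.re) {h : ℝ} (hp : p.im ≠ h)
    (hq : q.im ≠ h) :
    ∫ t : ℝ, polarKernel p q 0 (t + h * I) =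
      -(I * Real.pi) * (|h - p.im| / (h - p.im) - |h - q.im| / (h - q.im) : ℝ) := by
  set α := h - p.im with hα
  set β := h - q.im with hβ
  have hα0 : α ≠ 0 := sub_ne_zero.2 hp.symm
  have hβ0 : β ≠ 0 := sub_ne_zero.2 hq.symm
  have hne : ∀ (γ : ℝ), γ ≠ 0 → ∀ t : ℝ, (t : ℂ) + γ * I ≠ 0 := by
    intro γ hγ t h0
    apply hγ
    simpa using congrArg im h0
  set E : ℝ → ℂ := fun t => ((t : ℂ) + α * I)⁻¹ - ((t : ℂ) + β * I)⁻¹ with hE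
  have hline : ∀ t : ℝ, polarKernel p q 0 (t + h * I) = E (t - p.re) := by
    intro t
    have e1 : (t : ℂ) + h * I - p = ((t - p.re : ℝ) : ℂ) + α * I := by
      apply Complex.ext <;> simp [hα]
    have e2 : (t : ℂ) + h * I - q = ((t - p.re : ℝ) : ℂ) + β * I := by
      apply Complex.ext <;> simp [hβ, hpq]
    rw [polarKernel_zero_eq, e1, e2]
    · rw [← sub_ne_zero, e1]; exact hne α hα0 _
    · rw [← sub_ne_zero, e2]; exact hne β hβ0 _
  have hintegrable : Integrable fun t : ℝ => polarKernel p q 0 (t + h * I) := by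
    refine integrable_line (stripDecay_polarKernel p q 0) fun z hz => ?_
    refine (analyticAt_polarKernel ?_ ?_ 0).continuousAt
    · rintro rfl; exact hp hz
    · rintro rfl; exact hq hz
  have hintE : Integrable E := by
    have := hintegrable.comp_add_right p.re
    simpa only [hline, add_sub_cancel_right] using this
  simp_rw [hline]
  rw [integral_sub_right_eq_self E p.re]
  have hsum : ∫ t, (E t + E (-t)) = 2 * ∫ t, E t := by
    rw [integral_add hintE hintE.comp_neg, integral_neg_eq_self E, two_mul]
  have hval : ∀ t, E t + E (-t) = ((2 * (β / (t ^ 2 + β ^ 2) - α / (t ^ 2 + α ^ 2)) : ℝ) : ℂ) * I := by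
    intro t
    have key : ∀ γ : ℝ, γ ≠ 0 → ((t : ℂ) + γ * I)⁻¹ + (((-t : ℝ) : ℂ) + γ * I)⁻¹ =
        ((-2 * (γ / (t ^ 2 + γ ^ 2)) : ℝ) : ℂ) * I := by
      intro γ hγ
      have h1 := hne γ hγ t
      have h2 := hne γ hγ (-t)
      have h3 : (t : ℂ) ^ 2 + (γ : ℂ) ^ 2 ≠ 0 := by
        have : t ^ 2 + γ ^ 2 ≠ 0 := by positivity
        exact_mod_cast this
      push_cast at h2 ⊢
      field_simp
      linear_combination (2 * I * (γ : ℂ) ^ 3) * I_sq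
    have k1 := key α hα0
    have k2 := key β hβ0
    simp only [hE]
    calc _ = (((t : ℂ) + α * I)⁻¹ + (((-t : ℝ) : ℂ) + α * I)⁻¹) -
          (((t : ℂ) + β * I)⁻¹ + (((-t : ℝ) : ℂ) + β * I)⁻¹) := by ring
      _ = _ := by rw [k1, k2]; push_cast; ring
  have hreal : ∫ t : ℝ, (2 * (β / (t ^ 2 + β ^ 2) - α / (t ^ 2 + α ^ 2))) =
      2 * (|β| / β * Real.pi - |α| / α * Real.pi) := by
    rw [integral_const_mul, integral_sub (integrable_div_sq_add_sq hβ0)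
      (integrable_div_sq_add_sq hα0), integral_div_sq_add_sq hα0, integral_div_sq_add_sq hβ0]
  simp_rw [hval] at hsum
  rw [integral_mul_const, integral_complex_ofReal, hreal] at hsum
  have h2 : (2 : ℂ) ≠ 0 := by norm_num
  apply mul_left_cancel₀ h2
  rw [← hsum]
  push_cast
  ring

/-- Poles of order at least two have a single-valued primitive that vanishes at both ends of the
line. -/
theorem integral_polarKernel_succ {p q : ℂ} {h : ℝ} (hp : p.im ≠ h) (k : ℕ) :
    ∫ t : ℝ, polarKernel p q (k + 1) (t + h * I) = 0 := by
  have hne : ∀ t : ℝ, (t : ℂ) + h * I ≠ p := by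
    rintro t rfl
    simp at hp
  have hintegrable : Integrable fun t : ℝ => polarKernel p q (k + 1) (t + h * I) := by
    refine integrable_line (stripDecay_polarKernel p q _) fun z hz => ?_
    refine (analyticAt_inv_pow ?_ _).continuousAt
    rintro rfl; exact hp hz
  have hd : ∀ t : ℝ, HasDerivAt
      (fun t : ℝ => -(k + 1 : ℂ)⁻¹ * ((t : ℂ) + h * I - p)⁻¹ ^ (k + 1))
      (polarKernel p q (k + 1) (t + h * I)) t := by
    intro t
    have h0 : (t : ℂ) + h * I - p ≠ 0 := sub_ne_zero.2 (hne t)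
    have hk : (k : ℂ) + 1 ≠ 0 := by exact_mod_cast k.succ_ne_zero
    have h1 : HasDerivAt (fun t : ℝ => (t : ℂ) + h * I - p) 1 t :=
      ((hasDerivAt_id t).ofReal_comp.add_const _).sub_const _
    refine (((h1.fun_inv h0).fun_pow (k + 1)).const_mul (-(k + 1 : ℂ)⁻¹)).congr_deriv ?_
    simp only [polarKernel, inv_pow, add_tsub_cancel_right]
    push_cast
    field_simp
    ring
  have hlim : ∀ l : Filter ℝ, Tendsto (fun t : ℝ => |t|) l atTop →
      Tendsto (fun t : ℝ => -(k + 1 : ℂ)⁻¹ * ((t : ℂ) + h * I - p)⁻¹ ^ (k + 1)) l (𝓝 0) := by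
    intro l hl
    have h1 : Tendsto (fun t : ℝ => ((t : ℂ) + h * I - p)⁻¹) l (𝓝 0) := by
      rw [tendsto_zero_iff_norm_tendsto_zero]
      refine squeeze_zero' (Eventually.of_forall fun _ => norm_nonneg _) ?_
        (tendsto_const_nhds (x := (2 : ℝ)).div_atTop hl)
      filter_upwards [hl.eventually_ge_atTop (2 * |p.re| + 1)] with t ht
      simpa using norm_inv_sub_le (p := p) (z := t + h * I) (by simpa using ht)
    simpa using (h1.pow (k + 1)).const_mul (-(k + 1 : ℂ)⁻¹)
  have := integral_of_hasDerivAt_of_tendsto hd hintegrable (hlim _ tendsto_abs_atBot_atTop)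
    (hlim _ tendsto_abs_atTop_atTop)
  simpa using this

/-- The residue theorem for a horizontal strip. -/
theorem integral_line_sub_integral_line {a b : ℝ} (hab : a ≤ b) (P : Finset ℂ) :
    ∀ f : ℂ → ℂ, StripDecay f → (∀ p ∈ P, a < p.im ∧ p.im < b ∧ MeromorphicAt f p) →
      (∀ z : ℂ, a ≤ z.im → z.im ≤ b → z ∉ P → AnalyticAt ℂ f z) →
      (∫ t : ℝ, f (t + a * I)) - ∫ t : ℝ, f (t + b * I) = ∑ p ∈ P, residue f p := by
  classical
  induction P using Finset.induction_on with
  | empty =>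
    intro f hf _ hA
    simpa [sub_eq_zero] using integral_line_eq_of_analyticAt hab hf
      fun z h1 h2 => hA z h1 h2 (by simp)
  | insert p P hpP ih =>
    intro f hf hP hA
    obtain ⟨hap, hpb, hm⟩ := hP p (Finset.mem_insert_self _ _)
    obtain ⟨n, c, r, hr, hfr⟩ := exists_principalPart hm
    -- The compensating pole lies above the strip, so it produces no residue inside, and has the
    -- abscissa of p, as the evaluation of the kernel requires.
    set q : ℂ := ⟨p.re, b + 1⟩ with hq
    set S : ℂ → ℂ := fun z => ∑ k ∈ Finset.range (n + 1), c k * polarKernel p q k z with hS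
    have hSd : StripDecay S := StripDecay.sum _ fun k => (stripDecay_polarKernel p q k).const_mul _
    have hSa : ∀ z, z ≠ p → z ≠ q → AnalyticAt ℂ S z := fun z h1 h2 =>
      Finset.analyticAt_fun_sum _ fun k _ => analyticAt_const.mul (analyticAt_polarKernel h1 h2 k)
    have hpq : p ≠ q := by
      intro h
      have := congrArg im h
      simp [hq] at this
      linarith
    have hqz : ∀ z : ℂ, z.im ≤ b → z ≠ q := by
      rintro z hz rfl
      simp [hq] at hz
      linarith
    set G : ℂ → ℂ := fun z => r z + c 0 * (z - q)⁻¹ with hG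
    have hGa : AnalyticAt ℂ G p := by
      have := sub_ne_zero.2 hpq
      have h2 : AnalyticAt ℂ (fun z : ℂ => (z - q)⁻¹) p := by fun_prop (disch := assumption)
      exact hr.add (analyticAt_const.mul h2)
    have hfS : ∀ᶠ z in 𝓝[≠] p, f z - S z = G z := by
      have hqe : ∀ᶠ z in 𝓝[≠] p, z ≠ q := eventually_nhdsWithin_of_eventually_nhds
        (isOpen_ne.mem_nhds hpq)
      filter_upwards [hfr, hqe, self_mem_nhdsWithin] with z hz h1 h2
      rw [hz, hS]
      simp only [Finset.sum_range_succ', polarKernel_zero_eq h2 h1]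
      simp only [polarKernel, hG]
      ring
    -- Subtracting S leaves a removable singularity at p; filling it with the value of G makes F
    -- analytic there, and the induction hypothesis applies to F with one pole fewer.
    set F : ℂ → ℂ := Function.update (fun z => f z - S z) p (G p) with hF
    have hFne : ∀ z, z ≠ p → F z = f z - S z := fun z hz => Function.update_of_ne hz _ _
    have hFp : F =ᶠ[𝓝 p] G := by
      rw [eventually_nhdsWithin_iff] at hfS
      filter_upwards [hfS] with z hz
      by_cases h : z = p
      · rw [h, hF, Function.update_self]
      · rw [hFne z h, hz h]
    have hFz : ∀ z, z ≠ p → F =ᶠ[𝓝 z] fun z => f z - S z := fun z hz => by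
      filter_upwards [isOpen_ne.mem_nhds hz] with w hw using hFne w hw
    have hFd : StripDecay F := by
      refine (hf.add (hSd.const_mul (-1))).congr p fun z hz => ?_
      rw [hFne z hz]
      ring
    have hres : ∀ p' ∈ P, residue F p' = residue f p' := by
      intro p' hp'
      have hne : p' ≠ p := fun h => hpP (h ▸ hp')
      obtain ⟨_, h2, h3⟩ := hP p' (Finset.mem_insert_of_mem hp')
      have hSp := hSa p' hne (hqz p' h2.le)
      refine HasResidue.residue_eq ?_
      have h5 : HasResidue (fun z => f z + -1 * S z) p' (residue f p' + -1 * 0) :=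
        (hasResidue_residue h3).add ((hasResidue_of_analyticAt hSp).const_mul (-1)) h3
          ((MeromorphicAt.const _ _).mul hSp.meromorphicAt)
      rw [mul_zero, add_zero] at h5
      refine h5.congr (((hFz p' hne).mono fun z hz => ?_).filter_mono nhdsWithin_le_nhds)
      rw [hz]
      ring
    have hmain := ih F hFd (fun p' hp' => by
      have hne : p' ≠ p := fun h => hpP (h ▸ hp')
      obtain ⟨h1, h2, h3⟩ := hP p' (Finset.mem_insert_of_mem hp')
      refine ⟨h1, h2, ?_⟩
      exact (h3.sub (hSa p' hne (hqz p' h2.le)).meromorphicAt).congr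
        ((hFz p' hne).symm.filter_mono nhdsWithin_le_nhds)) (fun z h1 h2 h3 => by
      by_cases hz : z = p
      · rw [hz]; exact hGa.congr hFp.symm
      · exact ((hA z h1 h2 (by simp [hz, h3])).sub (hSa z hz (hqz z h2))).congr (hFz z hz).symm)
    rw [Finset.sum_insert hpP, ← Finset.sum_congr rfl hres, ← hmain]
    have hline : ∀ h : ℝ, a ≤ h → h ≤ b → h ≠ p.im → (∀ p' ∈ P, h ≠ p'.im) →
        ∫ t : ℝ, F (t + h * I) = (∫ t : ℝ, f (t + h * I)) - c 0 *
          ∫ t : ℝ, polarKernel p q 0 (t + h * I) := by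
      intro h h1 h2 h3 h4
      have hi : ∀ k, Integrable fun t : ℝ => polarKernel p q k (t + h * I) := fun k => by
        refine integrable_line (stripDecay_polarKernel p q _) fun z hz => ?_
        refine (analyticAt_polarKernel ?_ (hqz z (hz.trans_le h2)) _).continuousAt
        rintro rfl; exact h3 hz.symm
      have hif : Integrable fun t : ℝ => f (t + h * I) := by
        refine integrable_line hf fun z hz => (hA z (h1.trans hz.ge) (hz.trans_le h2) ?_).continuousAt
        rw [Finset.mem_insert]
        rintro (rfl | h')
        · exact h3 hz.symm
        · exact h4 z h' hz.symm
      have hiS : Integrable fun t : ℝ => S (t + h * I) :=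
        integrable_finsetSum _ fun k _ => (hi k).const_mul _
      have hcongr : ∀ t : ℝ, F (t + h * I) = f (t + h * I) - S (t + h * I) := fun t => by
        refine hFne _ ?_
        rintro rfl
        simp at h3
      simp_rw [hcongr]
      rw [integral_sub hif hiS]
      simp only [hS]
      rw [integral_finsetSum _ fun k _ => (hi k).const_mul _]
      simp_rw [integral_const_mul]
      rw [Finset.sum_range_succ', Finset.sum_eq_zero, zero_add]
      intro k _
      rw [integral_polarKernel_succ h3.symm, mul_zero]
    rw [hline a le_rfl hab hap.ne fun p' hp' => (hP p' (Finset.mem_insert_of_mem hp')).1.ne,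
      hline b hab le_rfl hpb.ne' fun p' hp' => (hP p' (Finset.mem_insert_of_mem hp')).2.1.ne',
      integral_polarKernel_zero (p := p) (q := q) rfl hap.ne' (by simp [hq]; linarith),
      integral_polarKernel_zero (p := p) (q := q) rfl hpb.ne (by simp [hq])]
    have hrp : residue f p = c 0 * (2 * Real.pi * I) := by
      refine HasResidue.residue_eq ?_
      have := (hasResidue_sum_inv_pow p n c).add (hasResidue_of_analyticAt hr)
        (meromorphicAt_sum_inv_pow p p _ c) hr.meromorphicAt
      rw [add_zero] at this
      exact this.congr hfr.symm
    rw [hrp]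
    -- Only p lies on different sides of the two lines, so the terms from q cancel in the difference
    -- and the terms from p add up to 2πi times `c 0`.
    have e1 : |a - p.im| / (a - p.im) = -1 := by
      rw [abs_of_neg (by linarith), neg_div, div_self (by linarith)]
    have e2 : |a - q.im| / (a - q.im) = -1 := by
      have : a - q.im < 0 := by simp [hq]; linarith
      rw [abs_of_neg this, neg_div, div_self this.ne]
    have e3 : |b - p.im| / (b - p.im) = 1 := by
      rw [abs_of_pos (by linarith), div_self (by linarith)]
    have e4 : |b - q.im| / (b - q.im) = -1 := by
      have : b - q.im < 0 := by simp [hq]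
      rw [abs_of_neg this, neg_div, div_self this.ne]
    rw [e1, e2, e3, e4]
    push_cast
    ring

/-! ### Contour integrals that separate two families of poles -/

/-- Two disjoint families of points, the first one finite below and the second one finite above
every horizontal line. -/
structure PoleFamilies (U D : Set ℂ) : Prop where
  disjoint : Disjoint U D
  finite_below : ∀ h : ℝ, {p ∈ U | p.im ≤ h}.Finite
  finite_above : ∀ h : ℝ, {p ∈ D | h ≤ p.im}.Finite

/-- A meromorphic function with quadratic decay in strips and no poles outside `S`. -/
structure DecayingMeromorphic (f : ℂ → ℂ) (S : Set ℂ) : Prop where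
  decay : StripDecay f
  meromorphic : ∀ z, MeromorphicAt f z
  analytic : ∀ z ∉ S, AnalyticAt ℂ f z

namespace DecayingMeromorphic

theorem mono {f : ℂ → ℂ} {S T : Set ℂ} (hf : DecayingMeromorphic f S) (h : S ⊆ T) :
    DecayingMeromorphic f T :=
  ⟨hf.decay, hf.meromorphic, fun z hz => hf.analytic z fun h' => hz (h h')⟩

theorem add {f g : ℂ → ℂ} {S : Set ℂ} (hf : DecayingMeromorphic f S)
    (hg : DecayingMeromorphic g S) : DecayingMeromorphic (fun z => f z + g z) S :=
  ⟨hf.decay.add hg.decay, fun z => (hf.meromorphic z).add (hg.meromorphic z),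
    fun z hz => (hf.analytic z hz).add (hg.analytic z hz)⟩

theorem const_mul {f : ℂ → ℂ} {S : Set ℂ} (hf : DecayingMeromorphic f S) (c : ℂ) :
    DecayingMeromorphic (fun z => c * f z) S :=
  ⟨hf.decay.const_mul c, fun z => (MeromorphicAt.const c z).mul (hf.meromorphic z),
    fun z hz => analyticAt_const.mul (hf.analytic z hz)⟩

end DecayingMeromorphic

/-- The integral of `f` along any contour with `U` above it and `D` below it, computed from the
line at height `h` and the residues on the wrong side of this line. -/
noncomputable def separatingIntegral (U D : Set ℂ) (f : ℂ → ℂ) (h : ℝ) : ℂ :=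
  (∫ t : ℝ, f (t + h * I)) + (∑ᶠ p ∈ {p ∈ U | p.im < h}, residue f p) -
    ∑ᶠ p ∈ {p ∈ D | h < p.im}, residue f p

section

variable {U D U' D' : Set ℂ} {f g : ℂ → ℂ} {h h' : ℝ}

theorem PoleFamilies.finite_lt (hUD : PoleFamilies U D) (h : ℝ) : {p ∈ U | p.im < h}.Finite :=
  (hUD.finite_below h).subset fun _ hp => ⟨hp.1, le_of_lt hp.2⟩

theorem PoleFamilies.finite_gt (hUD : PoleFamilies U D) (h : ℝ) : {p ∈ D | h < p.im}.Finite :=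
  (hUD.finite_above h).subset fun _ hp => ⟨hp.1, le_of_lt hp.2⟩

theorem DecayingMeromorphic.integrable_line (hf : DecayingMeromorphic f (U ∪ D))
    (hh : ∀ p ∈ U ∪ D, p.im ≠ h) : Integrable fun t : ℝ => f (t + h * I) :=
  NestedBethe.integrable_line hf.decay fun z hz =>
    (hf.analytic z fun hz' => hh z hz' hz).continuousAt

/-- Raising the line loses the residues in the strip between the two heights. Those of U join the
sum of points below the line and those of D leave the subtracted sum of points above it, which
compensates exactly. -/
theorem separatingIntegral_eq_of_lt (hUD : PoleFamilies U D)
    (hf : DecayingMeromorphic f (U ∪ D)) (hh : ∀ p ∈ U ∪ D, p.im ≠ h)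
    (hh' : ∀ p ∈ U ∪ D, p.im ≠ h') (hlt : h < h') :
    separatingIntegral U D f h = separatingIntegral U D f h' := by
  set A : Set ℂ := {p ∈ U | h < p.im ∧ p.im < h'} with hA
  set B : Set ℂ := {p ∈ D | h < p.im ∧ p.im < h'} with hB
  have hAf : A.Finite := (hUD.finite_below h').subset fun p hp => ⟨hp.1, hp.2.2.le⟩
  have hBf : B.Finite := (hUD.finite_above h).subset fun p hp => ⟨hp.1, hp.2.1.le⟩
  have key := integral_line_sub_integral_line hlt.le (hAf.union hBf).toFinset f hf.decay
    (fun p hp => by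
      rw [Finite.mem_toFinset] at hp
      rcases hp with hp | hp
      · exact ⟨hp.2.1, hp.2.2, hf.meromorphic p⟩
      · exact ⟨hp.2.1, hp.2.2, hf.meromorphic p⟩)
    (fun z h1 h2 hz => by
      refine hf.analytic z fun hz' => hz ?_
      have h3 := lt_of_le_of_ne h1 (hh z hz').symm
      have h4 := lt_of_le_of_ne h2 (hh' z hz')
      rw [Finite.mem_toFinset]
      rcases hz' with hz' | hz'
      · exact Or.inl ⟨hz', h3, h4⟩
      · exact Or.inr ⟨hz', h3, h4⟩)
  rw [← finsum_mem_eq_finite_toFinset_sum, finsum_mem_union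
    (hUD.disjoint.mono (fun p hp => hp.1) (fun p hp => hp.1)) hAf hBf] at key
  have hU : {p ∈ U | p.im < h'} = {p ∈ U | p.im < h} ∪ A := by
    ext p
    simp only [mem_union, mem_ofPred_eq, hA]
    constructor
    · rintro ⟨h1, h2⟩
      rcases lt_or_gt_of_ne (hh p (Or.inl h1)) with h3 | h3
      · exact Or.inl ⟨h1, h3⟩
      · exact Or.inr ⟨h1, h3, h2⟩
    · rintro (⟨h1, h2⟩ | ⟨h1, h2, h3⟩)
      · exact ⟨h1, h2.trans hlt⟩
      · exact ⟨h1, h3⟩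
  have hD : {p ∈ D | h < p.im} = {p ∈ D | h' < p.im} ∪ B := by
    ext p
    simp only [mem_union, mem_ofPred_eq, hB]
    constructor
    · rintro ⟨h1, h2⟩
      rcases lt_or_gt_of_ne (hh' p (Or.inr h1)) with h3 | h3
      · exact Or.inr ⟨h1, h2, h3⟩
      · exact Or.inl ⟨h1, h3⟩
    · rintro (⟨h1, h2⟩ | ⟨h1, h2, h3⟩)
      · exact ⟨h1, hlt.trans h2⟩
      · exact ⟨h1, h2⟩
  unfold separatingIntegral
  rw [hU, hD, finsum_mem_union _ (hUD.finite_lt h) hAf,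
    finsum_mem_union _ (hUD.finite_gt h') hBf]
  · linear_combination key
  · rw [Set.disjoint_left]
    rintro p ⟨_, h1⟩ ⟨_, _, h2⟩
    exact lt_asymm h1 h2
  · rw [Set.disjoint_left]
    rintro p ⟨_, h1⟩ ⟨_, h2, _⟩
    exact lt_asymm h1 h2

theorem separatingIntegral_eq (hUD : PoleFamilies U D)
    (hf : DecayingMeromorphic f (U ∪ D)) (hh : ∀ p ∈ U ∪ D, p.im ≠ h)
    (hh' : ∀ p ∈ U ∪ D, p.im ≠ h') :
    separatingIntegral U D f h = separatingIntegral U D f h' := by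
  rcases lt_trichotomy h h' with hlt | rfl | hlt
  · exact separatingIntegral_eq_of_lt hUD hf hh hh' hlt
  · rfl
  · exact (separatingIntegral_eq_of_lt hUD hf hh' hh hlt).symm

theorem residue_eq_zero {p : ℂ} (hf : AnalyticAt ℂ f p) : residue f p = 0 :=
  (hasResidue_of_analyticAt hf).residue_eq

/-- An added point is a pole of neither family: by disjointness of U' and D', a point of U' outside
U is not in D either, so f is analytic there and its residue is 0. This lets integrands with
different poles be compared over one pair of families. -/
theorem separatingIntegral_mono (hUD : Disjoint U' D') (hU : U ⊆ U') (hD : D ⊆ D')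
    (hf : DecayingMeromorphic f (U ∪ D)) :
    separatingIntegral U D f h = separatingIntegral U' D' f h := by
  unfold separatingIntegral
  refine congrArg₂ (· - ·) (congrArg₂ (· + ·) rfl ?_) ?_
  · refine finsum_mem_inter_support_eq _ _ _ ?_
    ext p
    simp only [mem_inter_iff, mem_ofPred_eq, Function.mem_support]
    refine ⟨fun ⟨⟨h1, h2⟩, h3⟩ => ⟨⟨hU h1, h2⟩, h3⟩, fun ⟨⟨h1, h2⟩, h3⟩ => ⟨⟨?_, h2⟩, h3⟩⟩
    by_contra h4
    exact h3 (residue_eq_zero (hf.analytic p fun h5 =>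
      h5.elim h4 fun h6 => hUD.le_bot ⟨h1, hD h6⟩))
  · refine finsum_mem_inter_support_eq _ _ _ ?_
    ext p
    simp only [mem_inter_iff, mem_ofPred_eq, Function.mem_support]
    refine ⟨fun ⟨⟨h1, h2⟩, h3⟩ => ⟨⟨hD h1, h2⟩, h3⟩, fun ⟨⟨h1, h2⟩, h3⟩ => ⟨⟨?_, h2⟩, h3⟩⟩
    by_contra h4
    exact h3 (residue_eq_zero (hf.analytic p fun h5 =>
      h5.elim (fun h6 => hUD.le_bot ⟨hU h6, h1⟩) h4))

theorem residue_add {p : ℂ} (hf : MeromorphicAt f p) (hg : MeromorphicAt g p) :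
    residue (fun z => f z + g z) p = residue f p + residue g p :=
  ((hasResidue_residue hf).add (hasResidue_residue hg) hf hg).residue_eq

theorem residue_const_mul {p : ℂ} (hf : MeromorphicAt f p) (c : ℂ) :
    residue (fun z => c * f z) p = c * residue f p :=
  ((hasResidue_residue hf).const_mul c).residue_eq

theorem separatingIntegral_add (hUD : PoleFamilies U D) (hf : DecayingMeromorphic f (U ∪ D))
    (hg : DecayingMeromorphic g (U ∪ D)) (hh : ∀ p ∈ U ∪ D, p.im ≠ h) :
    separatingIntegral U D (fun z => f z + g z) h =
      separatingIntegral U D f h + separatingIntegral U D g h := by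
  unfold separatingIntegral
  rw [integral_add (hf.integrable_line hh) (hg.integrable_line hh)]
  simp_rw [fun p => residue_add (hf.meromorphic p) (hg.meromorphic p)]
  rw [finsum_mem_add_distrib (hUD.finite_lt h), finsum_mem_add_distrib (hUD.finite_gt h)]
  ring

theorem separatingIntegral_const_mul (hf : DecayingMeromorphic f (U ∪ D)) (c : ℂ) :
    separatingIntegral U D (fun z => c * f z) h = c * separatingIntegral U D f h := by
  unfold separatingIntegral
  rw [integral_const_mul]
  simp_rw [fun p => residue_const_mul (hf.meromorphic p) c]
  rw [← mul_finsum_mem, ← mul_finsum_mem]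
  ring

theorem residue_comp_add_right (f : ℂ → ℂ) (w p : ℂ) :
    residue (fun z => f (z + w)) p = residue f (p + w) := by
  unfold residue
  congr 1
  ext r
  simp only [circleIntegral, deriv_circleMap]
  congr 1
  ext t
  simp only [circleMap]
  rw [add_right_comm]

theorem finsum_residue_comp_add_right (f : ℂ → ℂ) (w : ℂ) (S T : Set ℂ)
    (hST : ∀ z, z + w ∈ T ↔ z ∈ S) :
    ∑ᶠ p ∈ S, residue (fun z => f (z + w)) p = ∑ᶠ p ∈ T, residue f p := by
  refine finsum_mem_eq_of_bijOn (fun z => z + w) ⟨fun z hz => (hST z).2 hz,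
    (add_left_injective w).injOn, fun z hz => ⟨z - w, ?_, by simp⟩⟩
    fun p _ => residue_comp_add_right f w p
  rwa [← hST, sub_add_cancel]

theorem separatingIntegral_comp_add_right (f : ℂ → ℂ) (τ : ℝ)
    (hU : ∀ z, z + τ * I ∈ U' ↔ z ∈ U) (hD : ∀ z, z + τ * I ∈ D' ↔ z ∈ D) :
    separatingIntegral U D (fun z => f (z + τ * I)) h = separatingIntegral U' D' f (h + τ) := by
  unfold separatingIntegral
  refine congrArg₂ (· - ·) (congrArg₂ (· + ·) ?_ ?_) ?_
  · congr 1
    ext t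
    push_cast
    rw [add_mul, add_assoc]
  · refine finsum_residue_comp_add_right f (τ * I) _ _ fun z => ?_
    simp [hU]
  · refine finsum_residue_comp_add_right f (τ * I) _ _ fun z => ?_
    simp [hD]

end

/-! ### Reduction of integrals along separating contours to lines and residues. -/

namespace Contour

variable {C : Contour} {U D : Set ℂ} {f : ℂ → ℂ}

theorem Separates.analyticAt_of_mem_closedBall (hC : C.Separates U D)
    (hf : DecayingMeromorphic f (U ∪ D)) {p z : ℂ} (hp : p ∈ U ∪ D)
    (hz : z ∈ Metric.closedBall p C.radius) (hne : z ≠ p) : AnalyticAt ℂ f z := by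
  refine hf.analytic z fun hz' => ?_
  exact absurd (Metric.mem_closedBall.1 hz) (not_le.2 (hC.radius_lt z hz' p hp hne))

theorem Separates.mem_of_mem (hC : C.Separates U D) {p : ℂ} (hp : p ∈ C.ccw ∪ C.cw) :
    p ∈ U ∪ D := by
  rcases Finset.mem_union.1 hp with h | h
  · exact Or.inl ((hC.mem_ccw p).1 h).1
  · exact Or.inr ((hC.mem_cw p).1 h).1

theorem Separates.circleIntegral_eq (hC : C.Separates U D)
    (hf : DecayingMeromorphic f (U ∪ D)) {p : ℂ} (hp : p ∈ C.ccw ∪ C.cw) :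
    circleIntegral f p C.radius = residue f p :=
  circleIntegral_eq_residue hC.radius_pos
    (fun _ hz hne => hC.analyticAt_of_mem_closedBall hf (hC.mem_of_mem hp) hz hne)
    (hf.meromorphic p)

/-- Each circle surrounds no pole other than its centre and therefore yields the residue there, and
the centres are precisely the points on the wrong side of the line. -/
theorem Separates.integral_eq (hC : C.Separates U D) (hf : DecayingMeromorphic f (U ∪ D)) :
    C.integral f = separatingIntegral U D f C.height := by
  unfold Contour.integral separatingIntegral
  congr 2
  · rw [Finset.sum_congr rfl fun p hp => hC.circleIntegral_eq hf (Finset.mem_union_left _ hp),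
      ← finsum_mem_coe_finset]
    refine finsum_mem_congr (Set.ext fun p => ?_) fun _ _ => rfl
    simp [hC.mem_ccw]
  · rw [Finset.sum_congr rfl fun p hp => hC.circleIntegral_eq hf (Finset.mem_union_right _ hp),
      ← finsum_mem_coe_finset]
    refine finsum_mem_congr (Set.ext fun p => ?_) fun _ _ => rfl
    simp [hC.mem_cw]

theorem Separates.integrable (hC : C.Separates U D) (hf : DecayingMeromorphic f (U ∪ D)) :
    C.Integrable f := by
  refine ⟨hf.integrable_line hC.line, fun p hp => ?_⟩
  refine ContinuousOn.circleIntegrable hC.radius_pos.le fun z hz => ?_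
  refine (hC.analyticAt_of_mem_closedBall hf (hC.mem_of_mem hp)
    (Metric.sphere_subset_closedBall hz) ?_).continuousAt.continuousWithinAt
  rintro rfl
  simp at hz
  exact hC.radius_pos.ne hz

/-- The points of a separating contour avoid both families. -/
theorem Separates.notMem_of_mem_points (hC : C.Separates U D) {u : ℂ} (hu : u ∈ C.points) :
    u ∉ U ∪ D := by
  intro hu'
  rcases hu with hu | ⟨p, hp, hu⟩
  · exact hC.line u hu' hu
  · by_cases h : u = p
    · rw [h, sub_self, norm_zero] at hu
      exact hC.radius_pos.ne hu
    · have := hC.radius_lt u hu' p (hC.mem_of_mem hp) h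
      rw [dist_eq_norm, hu] at this
      exact lt_irrefl _ this

/-- Agreement on the contour itself is all that is available in a nested integral, since the inner
integral is known only where its poles stay disjoint. -/
theorem integral_congr {f g : ℂ → ℂ} (h0 : 0 ≤ C.radius) (h : ∀ u ∈ C.points, f u = g u) :
    C.integral f = C.integral g := by
  unfold Contour.integral
  refine congrArg₂ (· - ·) (congrArg₂ (· + ·) ?_ ?_) ?_
  · congr 1
    ext t
    exact h _ (Or.inl (by simp))
  · exact Finset.sum_congr rfl fun p hp => circleIntegral.integral_congr h0 fun z hz =>
      h z (Or.inr ⟨p, Finset.mem_union_left _ hp, by simpa [dist_eq_norm] using hz⟩)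
  · exact Finset.sum_congr rfl fun p hp => circleIntegral.integral_congr h0 fun z hz =>
      h z (Or.inr ⟨p, Finset.mem_union_right _ hp, by simpa [dist_eq_norm] using hz⟩)

theorem Integrable.congr {f g : ℂ → ℂ} (hf : C.Integrable f) (h0 : 0 ≤ C.radius)
    (h : ∀ u ∈ C.points, f u = g u) : C.Integrable g := by
  refine ⟨hf.1.congr (Eventually.of_forall fun t => h _ (Or.inl (by simp))), fun p hp => ?_⟩
  refine (circleIntegrable_congr fun z hz => ?_).1 (hf.2 p hp)
  rw [abs_of_nonneg h0] at hz
  exact h z (Or.inr ⟨p, hp, by simpa [dist_eq_norm] using hz⟩)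

end Contour

/-! ### Analytic properties of the Gamma function -/

theorem meromorphicAt_Gamma (z : ℂ) : MeromorphicAt Gamma z := by
  have h := (differentiable_one_div_Gamma.analyticAt z).meromorphicAt.inv
  exact h.congr (Eventually.of_forall fun s => by simp)

theorem analyticAt_Gamma {z : ℂ} (hz : ∀ m : ℕ, z ≠ -m) : AnalyticAt ℂ Gamma z := by
  have h := (differentiable_one_div_Gamma.analyticAt z).inv (inv_ne_zero (Gamma_ne_zero hz))
  exact h.congr (Eventually.of_forall fun s => by simp)

theorem norm_Gamma_le_of_re_pos {z : ℂ} (hz : 0 < z.re) : ‖Gamma z‖ ≤ Real.Gamma z.re := by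
  rw [Gamma_eq_integral hz, Real.Gamma_eq_integral hz, GammaIntegral]
  refine (norm_integral_le_integral_norm _).trans (le_of_eq ?_)
  refine setIntegral_congr_fun measurableSet_Ioi fun t ht => ?_
  rw [norm_mul, norm_cpow_eq_rpow_re_of_pos ht, sub_re, one_re, norm_real,
    Real.norm_of_nonneg (Real.exp_pos _).le]

/-- Each use of Γ(z) = Γ(z + 1)/z gains a factor 1/|Im z|; after n steps the real part is at least
1, where |Γ(z)| ≤ Γ(Re z) is bounded on compact intervals. With n arbitrarily large this gives decay
of any order. -/
theorem exists_norm_Gamma_le (n : ℕ) : ∀ α β : ℝ, 1 ≤ α + n →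
    ∃ M : ℝ, 0 ≤ M ∧ ∀ z : ℂ, α ≤ z.re → z.re ≤ β → z.im ≠ 0 → ‖Gamma z‖ ≤ M / |z.im| ^ n := by
  induction n with
  | zero =>
    intro α β hα
    have hc : ContinuousOn Real.Gamma (Icc α β) := fun x hx => by
      refine (Real.differentiableAt_Gamma fun m hm => ?_).continuousAt.continuousWithinAt
      have := hx.1
      have h2 : (0 : ℝ) ≤ m := m.cast_nonneg
      simp at hα
      linarith
    obtain ⟨M, hM⟩ := isCompact_Icc.exists_bound_of_continuousOn hc
    refine ⟨|M|, abs_nonneg _, fun z h1 h2 _ => ?_⟩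
    simp only [CharP.cast_eq_zero, add_zero] at hα
    have := hM z.re ⟨h1, h2⟩
    rw [pow_zero, div_one]
    exact (norm_Gamma_le_of_re_pos (by linarith)).trans
      (((le_abs_self _).trans this).trans (le_abs_self M))
  | succ n ih =>
    intro α β hα
    obtain ⟨M, hM0, hM⟩ := ih (α + 1) (β + 1) (by push_cast at hα; linarith)
    refine ⟨M, hM0, fun z h1 h2 h3 => ?_⟩
    have hz : z ≠ 0 := by rintro rfl; exact h3 rfl
    have h4 := hM (z + 1) (by simpa using h1) (by simpa using h2) (by simpa using h3)
    rw [Gamma_add_one z hz, norm_mul] at h4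
    have h5 : 0 < |z.im| := abs_pos.2 h3
    rw [pow_succ, le_div_iff₀ (by positivity)]
    simp only [add_im, one_im, add_zero] at h4
    rw [le_div_iff₀ (by positivity)] at h4
    calc ‖Gamma z‖ * (|z.im| ^ n * |z.im|) = |z.im| * ‖Gamma z‖ * |z.im| ^ n := by ring
      _ ≤ ‖z‖ * ‖Gamma z‖ * |z.im| ^ n := by gcongr; exact abs_im_le_norm z
      _ ≤ M := h4

theorem exists_norm_Gamma_le_div_sq (α β : ℝ) :
    ∃ M : ℝ, 0 ≤ M ∧ ∀ z : ℂ, α ≤ z.re → z.re ≤ β → 1 ≤ |z.im| → ‖Gamma z‖ ≤ M / z.im ^ 2 := by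
  obtain ⟨n, hn⟩ := exists_nat_ge (1 - α)
  obtain ⟨M, hM0, hM⟩ := exists_norm_Gamma_le (n + 2) α β (by push_cast; linarith)
  refine ⟨M, hM0, fun z h1 h2 h3 => ?_⟩
  refine (hM z h1 h2 (fun h => by simp [h] at h3; linarith)).trans ?_
  rw [← sq_abs z.im]
  exact div_le_div_of_nonneg_left hM0 (by positivity) (pow_le_pow_right₀ h3 (by omega))

theorem stripDecay_Gamma_comp (a : ℂ) {r : ℝ} (hr : r ≠ 0) :
    StripDecay fun u => Gamma (a + r * I * u) := by
  intro α β
  set L := |r| * (|α| + |β|) with hL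
  obtain ⟨M, hM0, hM⟩ := exists_norm_Gamma_le_div_sq (a.re - L) (a.re + L)
  have hr' : 0 < |r| := abs_pos.2 hr
  -- Beyond this threshold the imaginary part of the argument is at least |r · Re u|/2 and at least
  -- 1; squaring the factor 1/2 gives the 4.
  refine ⟨4 * M / r ^ 2, (2 * |a.im| + 2) / |r|, fun u h1 h2 h3 => ?_⟩
  rw [div_le_iff₀ hr'] at h3
  have him : (a + r * I * u).im = a.im + r * u.re := by simp
  have hre : (a + r * I * u).re = a.re - r * u.im := by simp [sub_eq_add_neg]
  have hu : |u.im| ≤ |α| + |β| := by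
    rw [abs_le]
    constructor
    · linarith [neg_abs_le α, abs_nonneg β]
    · linarith [le_abs_self β, abs_nonneg α]
  have h4 : |r * u.im| ≤ L := by
    rw [abs_mul]
    exact mul_le_mul_of_nonneg_left hu hr'.le
  rw [abs_le] at h4
  have h5 : |r| * |u.re| / 2 ≤ |a.im + r * u.re| := by
    have := abs_sub_abs_le_abs_sub (r * u.re) (-a.im)
    rw [abs_neg, sub_neg_eq_add, abs_mul, add_comm (r * u.re)] at this
    nlinarith
  have h6 := hM (a + r * I * u) (by rw [hre]; linarith) (by rw [hre]; linarith)
    (by rw [him]; linarith [abs_nonneg a.im])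
  refine h6.trans ?_
  rw [him, ← sq_abs (a.im + r * u.re)]
  have h7 : 0 < |r| * |u.re| / 2 := by linarith [abs_nonneg a.im]
  refine (div_le_div_of_nonneg_left hM0 (by positivity) (pow_le_pow_left₀ h7.le h5 2)).trans
    (le_of_eq ?_)
  rw [div_pow, mul_pow, sq_abs, sq_abs]
  have h8 : u.re ≠ 0 := by
    rintro h
    simp [h] at h7
  field_simp
  norm_num

theorem StripDecay.mul {f g : ℂ → ℂ} (hf : StripDecay f) (hg : StripDecay g) :
    StripDecay fun z => f z * g z := by
  intro a b
  obtain ⟨C, T, h⟩ := hf a b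
  obtain ⟨C', T', h'⟩ := hg a b
  refine ⟨|C| * |C'|, max (max T T') 1, fun z h1 h2 h3 => ?_⟩
  have k1 : 1 ≤ |z.re| := (le_max_right _ _).trans h3
  have k2 : 1 ≤ z.re ^ 2 := by rw [← sq_abs]; exact one_le_pow₀ k1
  have h4 := h z h1 h2 (((le_max_left _ _).trans (le_max_left _ _)).trans h3)
  have h5 := h' z h1 h2 (((le_max_right _ _).trans (le_max_left _ _)).trans h3)
  rw [norm_mul]
  have h6 : ‖g z‖ ≤ |C'| / z.re ^ 2 :=
    h5.trans (div_le_div_of_nonneg_right (le_abs_self _) (by positivity))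
  have h7 : ‖f z‖ ≤ |C| := by
    refine h4.trans ?_
    rw [div_le_iff₀ (by positivity)]
    nlinarith [le_abs_self C, abs_nonneg C]
  calc ‖f z‖ * ‖g z‖ ≤ |C| * (|C'| / z.re ^ 2) :=
        mul_le_mul h7 h6 (norm_nonneg _) (abs_nonneg _)
    _ = |C| * |C'| / z.re ^ 2 := by ring

/-! ### The integrand of the first Barnes lemma -/

/-- The integrand of the first Barnes lemma, in the variable `u = 2 π i s`. -/
noncomputable def barnesFun (a b c d u : ℂ) : ℂ :=
  Gamma (a + u / (2 * Real.pi * I)) * Gamma (b + u / (2 * Real.pi * I)) *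
    Gamma (c - u / (2 * Real.pi * I)) * Gamma (d - u / (2 * Real.pi * I))

/-- The poles of `Γ(c - s)` and `Γ(d - s)` in the variable `u = 2 π i s`. -/
def barnesAbove (c d : ℂ) : Set ℂ :=
  {u | ∃ k : ℕ, u = 2 * Real.pi * I * (c + k)} ∪ {u | ∃ k : ℕ, u = 2 * Real.pi * I * (d + k)}

/-- The poles of `Γ(a + s)` and `Γ(b + s)` in the variable `u = 2 π i s`. -/
def barnesBelow (a b : ℂ) : Set ℂ :=
  {u | ∃ k : ℕ, u = -(2 * Real.pi * I * (a + k))} ∪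
    {u | ∃ k : ℕ, u = -(2 * Real.pi * I * (b + k))}

theorem div_two_pi_I (u : ℂ) : u / (2 * Real.pi * I) = ((-(2 * Real.pi)⁻¹ : ℝ) : ℂ) * I * u := by
  have : (Real.pi : ℂ) ≠ 0 := by exact_mod_cast Real.pi_ne_zero
  push_cast
  field_simp
  rw [I_sq]
  ring

theorem two_pi_I_ne_zero' : (2 * Real.pi * I : ℂ) ≠ 0 := by
  simp [Real.pi_ne_zero]

theorem stripDecay_barnesFun (a b c d : ℂ) : StripDecay (barnesFun a b c d) := by
  have hr : (-(2 * Real.pi)⁻¹ : ℝ) ≠ 0 := by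
    have := Real.pi_pos
    exact neg_ne_zero.2 (by positivity)
  have hp : ∀ e : ℂ, StripDecay fun u => Gamma (e + u / (2 * Real.pi * I)) := fun e => by
    simp_rw [div_two_pi_I]
    exact stripDecay_Gamma_comp e hr
  have hm : ∀ e : ℂ, StripDecay fun u => Gamma (e - u / (2 * Real.pi * I)) := fun e => by
    have := stripDecay_Gamma_comp e (neg_ne_zero.2 hr)
    simp_rw [div_two_pi_I]
    convert this using 4
    push_cast
    ring
  exact (((hp a).mul (hp b)).mul (hm c)).mul (hm d)

theorem decayingMeromorphic_barnesFun (a b c d : ℂ) :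
    DecayingMeromorphic (barnesFun a b c d) (barnesAbove c d ∪ barnesBelow a b) := by
  have hl : ∀ u : ℂ, AnalyticAt ℂ (fun u => u / (2 * Real.pi * I)) u := fun u =>
    analyticAt_id.div_const
  refine ⟨stripDecay_barnesFun a b c d, fun u => ?_, fun u hu => ?_⟩
  · have hp : ∀ e : ℂ, MeromorphicAt (fun u => Gamma (e + u / (2 * Real.pi * I))) u := fun e =>
      (meromorphicAt_Gamma _).comp_analyticAt (analyticAt_const.add (hl u))
    have hm : ∀ e : ℂ, MeromorphicAt (fun u => Gamma (e - u / (2 * Real.pi * I))) u := fun e =>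
      (meromorphicAt_Gamma _).comp_analyticAt (analyticAt_const.sub (hl u))
    exact (((hp a).mul (hp b)).mul (hm c)).mul (hm d)
  · have hp : ∀ e : ℂ, (∀ k : ℕ, u ≠ -(2 * Real.pi * I * (e + k))) →
        AnalyticAt ℂ (fun u => Gamma (e + u / (2 * Real.pi * I))) u := fun e he => by
      refine (analyticAt_Gamma fun m hm => he m ?_).fun_comp (analyticAt_const.add (hl u))
      have h := two_pi_I_ne_zero'
      field_simp at hm
      linear_combination hm
    have hm : ∀ e : ℂ, (∀ k : ℕ, u ≠ 2 * Real.pi * I * (e + k)) →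
        AnalyticAt ℂ (fun u => Gamma (e - u / (2 * Real.pi * I))) u := fun e he => by
      refine (analyticAt_Gamma fun m hm => he m ?_).fun_comp (analyticAt_const.sub (hl u))
      have h := two_pi_I_ne_zero'
      field_simp at hm
      linear_combination -hm
    exact (((hp a fun k h => hu (Or.inr (Or.inl ⟨k, h⟩))).mul
      (hp b fun k h => hu (Or.inr (Or.inr ⟨k, h⟩)))).mul
      (hm c fun k h => hu (Or.inl (Or.inl ⟨k, h⟩)))).mul
      (hm d fun k h => hu (Or.inl (Or.inr ⟨k, h⟩)))

theorem finite_progression_le (e : ℂ) (h : ℝ) :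
    {p ∈ {u : ℂ | ∃ k : ℕ, u = 2 * Real.pi * I * (e + k)} | p.im ≤ h}.Finite := by
  obtain ⟨K, hK⟩ := exists_nat_ge (h / (2 * Real.pi) - e.re)
  refine ((Finset.range (K + 1)).image fun k : ℕ => 2 * Real.pi * I * (e + k)).finite_toSet.subset ?_
  rintro p ⟨⟨k, rfl⟩, hk⟩
  rw [Finset.coe_image]
  refine ⟨k, ?_, rfl⟩
  have h1 : (2 * Real.pi * I * (e + k)).im = 2 * Real.pi * (e.re + k) := by simp
  rw [h1] at hk
  have h2 : (0 : ℝ) < 2 * Real.pi := by positivity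
  rw [mul_comm, ← le_div_iff₀ h2] at hk
  have h3 : (k : ℝ) ≤ K := by linarith
  simpa [Nat.lt_succ_iff] using (Nat.cast_le (α := ℝ)).1 h3

theorem finite_progression_ge (e : ℂ) (h : ℝ) :
    {p ∈ {u : ℂ | ∃ k : ℕ, u = -(2 * Real.pi * I * (e + k))} | h ≤ p.im}.Finite := by
  refine ((finite_progression_le e (-h)).image fun p => -p).subset ?_
  rintro p ⟨⟨k, rfl⟩, hk⟩
  exact ⟨_, ⟨⟨k, rfl⟩, by rw [neg_im] at hk; linarith⟩, rfl⟩

theorem poleFamilies_barnes {a b c d : ℂ} (h : Disjoint (barnesAbove c d) (barnesBelow a b)) :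
    PoleFamilies (barnesAbove c d) (barnesBelow a b) := by
  refine ⟨h, fun h => ?_, fun h => ?_⟩
  · refine ((finite_progression_le c h).union (finite_progression_le d h)).subset ?_
    rintro p ⟨hp | hp, hh⟩
    · exact Or.inl ⟨hp, hh⟩
    · exact Or.inr ⟨hp, hh⟩
  · refine ((finite_progression_ge a h).union (finite_progression_ge b h)).subset ?_
    rintro p ⟨hp | hp, hh⟩
    · exact Or.inl ⟨hp, hh⟩
    · exact Or.inr ⟨hp, hh⟩

/-! ### Raising the parameters of a Barnes integral -/

section

variable {U D : Set ℂ} {f g : ℂ → ℂ} {h : ℝ} {a b c d : ℂ}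

/-- Only finitely many points of U lie below height Im p + 1 and of D above height Im p - 1, so p is
not an accumulation point. -/
theorem PoleFamilies.eventually_notMem (hUD : PoleFamilies U D) (p : ℂ) :
    ∀ᶠ z in 𝓝[≠] p, z ∉ U ∪ D := by
  have hF := (hUD.finite_below (p.im + 1)).union (hUD.finite_above (p.im - 1))
  have h1 : ∀ᶠ z in 𝓝[≠] p, z ∉ {q ∈ U | q.im ≤ p.im + 1} ∪ {q ∈ D | p.im - 1 ≤ q.im} := by
    have := (hF.subset (sdiff_subset (t := {p}))).isClosed.isOpen_compl.mem_nhds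
      (show p ∈ (_)ᶜ from fun h => h.2 rfl)
    rw [eventually_nhdsWithin_iff]
    filter_upwards [this] with z hz hne h
    exact hz ⟨h, hne⟩
  have h2 : ∀ᶠ z in 𝓝[≠] p, z.im < p.im + 1 :=
    eventually_nhdsWithin_of_eventually_nhds
      (continuous_im.continuousAt.eventually_lt_const (by linarith))
  have h3 : ∀ᶠ z in 𝓝[≠] p, p.im - 1 < z.im :=
    eventually_nhdsWithin_of_eventually_nhds
      (continuous_im.continuousAt.eventually_const_lt (by linarith))
  filter_upwards [h1, h2, h3] with z h1 h2 h3 hz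
  exact h1 (hz.imp (fun h => ⟨h, h2.le⟩) fun h => ⟨h, h3.le⟩)

theorem residue_congr {p : ℂ} (hf : MeromorphicAt f p) (hfg : f =ᶠ[𝓝[≠] p] g) :
    residue f p = residue g p :=
  ((hasResidue_residue hf).congr hfg).residue_eq.symm

theorem separatingIntegral_congr (hUD : PoleFamilies U D) (hf : DecayingMeromorphic f (U ∪ D))
    (hh : ∀ p ∈ U ∪ D, p.im ≠ h) (hfg : ∀ z ∉ U ∪ D, f z = g z) :
    separatingIntegral U D f h = separatingIntegral U D g h := by
  have hr : ∀ p, residue f p = residue g p := fun p =>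
    residue_congr (hf.meromorphic p) ((hUD.eventually_notMem p).mono hfg)
  unfold separatingIntegral
  simp_rw [hr]
  congr 3
  ext t
  exact hfg _ fun h' => hh _ h' (by simp)

theorem barnesAbove_add_one_subset (c d : ℂ) : barnesAbove (c + 1) (d + 1) ⊆ barnesAbove c d := by
  rintro u (⟨k, rfl⟩ | ⟨k, rfl⟩)
  · exact Or.inl ⟨k + 1, by push_cast; ring⟩
  · exact Or.inr ⟨k + 1, by push_cast; ring⟩

theorem barnesAbove_add_one_right_subset (c d : ℂ) : barnesAbove c (d + 1) ⊆ barnesAbove c d := by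
  rintro u (⟨k, rfl⟩ | ⟨k, rfl⟩)
  · exact Or.inl ⟨k, rfl⟩
  · exact Or.inr ⟨k + 1, by push_cast; ring⟩

theorem barnesBelow_add_one_left_subset (a b : ℂ) : barnesBelow (a + 1) b ⊆ barnesBelow a b := by
  rintro u (⟨k, rfl⟩ | ⟨k, rfl⟩)
  · exact Or.inl ⟨k + 1, by push_cast; ring⟩
  · exact Or.inr ⟨k, rfl⟩

theorem barnesBelow_add_one_subset (a b : ℂ) :
    barnesBelow (a + 1) (b + 1) ⊆ barnesBelow a b := by
  rintro u (⟨k, rfl⟩ | ⟨k, rfl⟩)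
  · exact Or.inl ⟨k + 1, by push_cast; ring⟩
  · exact Or.inr ⟨k + 1, by push_cast; ring⟩

theorem barnesBelow_comm (a b : ℂ) : barnesBelow a b = barnesBelow b a := union_comm _ _

theorem barnesFun_comm_left (a b c d : ℂ) : barnesFun a b c d = barnesFun b a c d := by
  ext u
  simp only [barnesFun]
  ring

theorem add_two_pi_I_mem_barnesAbove {c d z : ℂ} :
    z + (2 * Real.pi : ℝ) * I ∈ barnesAbove (c + 1) (d + 1) ↔ z ∈ barnesAbove c d := by
  have : ∀ (e : ℂ) (k : ℕ), z + (2 * Real.pi : ℝ) * I = 2 * Real.pi * I * (e + 1 + k) ↔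
      z = 2 * Real.pi * I * (e + k) := fun e k => by
    push_cast
    constructor <;> intro h <;> linear_combination h
  exact or_congr (exists_congr fun k => this c k) (exists_congr fun k => this d k)

theorem add_two_pi_I_mem_barnesBelow {a b z : ℂ} :
    z + (2 * Real.pi : ℝ) * I ∈ barnesBelow a b ↔ z ∈ barnesBelow (a + 1) (b + 1) := by
  have : ∀ (e : ℂ) (k : ℕ), z + (2 * Real.pi : ℝ) * I = -(2 * Real.pi * I * (e + k)) ↔
      z = -(2 * Real.pi * I * (e + 1 + k)) := fun e k => by
    push_cast
    constructor <;> intro h <;> linear_combination h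
  exact or_congr (exists_congr fun k => this a k) (exists_congr fun k => this b k)

/-- Translating u by 2πi is s ↦ s + 1, which moves an integer shift from the upper to the lower
parameters. -/
theorem barnesFun_add_two_pi_I (a b c d z : ℂ) :
    barnesFun a b (c + 1) (d + 1) (z + (2 * Real.pi : ℝ) * I) =
      barnesFun (a + 1) (b + 1) c d z := by
  have h : (z + (2 * Real.pi : ℝ) * I) / (2 * Real.pi * I) = z / (2 * Real.pi * I) + 1 := by
    push_cast
    rw [add_div, div_self two_pi_I_ne_zero']
  simp only [barnesFun, h]
  rw [add_sub_add_right_eq_sub, add_sub_add_right_eq_sub, add_right_comm a 1, add_right_comm b 1,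
    add_assoc a _ 1, add_assoc b _ 1]

theorem disjoint_barnes_iff : Disjoint (barnesAbove c d) (barnesBelow a b) ↔
    ∀ k : ℕ, a + c ≠ -k ∧ a + d ≠ -k ∧ b + c ≠ -k ∧ b + d ≠ -k := by
  have hpi := two_pi_I_ne_zero'
  have h1 : ∀ (x y : ℂ) (k : ℕ), x + y = -k →
      2 * Real.pi * I * (y + k) = -(2 * Real.pi * I * (x + (0 : ℕ))) := fun x y k h => by
    push_cast
    linear_combination 2 * Real.pi * I * h
  have h2 : ∀ (x y : ℂ) (k l : ℕ), 2 * Real.pi * I * (y + k) = -(2 * Real.pi * I * (x + l)) →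
      x + y = -((k + l : ℕ) : ℂ) := fun x y k l h => by
    apply mul_left_cancel₀ hpi
    push_cast
    linear_combination h
  constructor
  · intro h k
    refine ⟨fun hk => ?_, fun hk => ?_, fun hk => ?_, fun hk => ?_⟩
    · exact h.le_bot ⟨Or.inl ⟨k, rfl⟩, Or.inl ⟨0, h1 _ _ _ hk⟩⟩
    · exact h.le_bot ⟨Or.inr ⟨k, rfl⟩, Or.inl ⟨0, h1 _ _ _ hk⟩⟩
    · exact h.le_bot ⟨Or.inl ⟨k, rfl⟩, Or.inr ⟨0, h1 _ _ _ hk⟩⟩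
    · exact h.le_bot ⟨Or.inr ⟨k, rfl⟩, Or.inr ⟨0, h1 _ _ _ hk⟩⟩
  · intro h
    rw [Set.disjoint_left]
    rintro u (⟨k, rfl⟩ | ⟨k, rfl⟩) (⟨l, hl⟩ | ⟨l, hl⟩)
    · exact (h (k + l)).1 (h2 _ _ _ _ hl)
    · exact (h (k + l)).2.2.1 (h2 _ _ _ _ hl)
    · exact (h (k + l)).2.1 (h2 _ _ _ _ hl)
    · exact (h (k + l)).2.2.2 (h2 _ _ _ _ hl)

/-- The functional equations of the Gamma functions in the integrand, away from the poles. -/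
theorem barnesFun_relations {u : ℂ} (hu : u ∉ barnesAbove c d ∪ barnesBelow a b) :
    barnesFun (a + 1) b c d u = (a + u / (2 * Real.pi * I)) * barnesFun a b c d u ∧
    barnesFun a b c (d + 1) u = (d - u / (2 * Real.pi * I)) * barnesFun a b c d u ∧
    barnesFun a b (c + 1) (d + 1) u = (c - u / (2 * Real.pi * I)) *
      (d - u / (2 * Real.pi * I)) * barnesFun a b c d u ∧
    barnesFun (a + 1) (b + 1) c d u = (a + u / (2 * Real.pi * I)) *
      (b + u / (2 * Real.pi * I)) * barnesFun a b c d u := by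
  have hpi := two_pi_I_ne_zero'
  have hs : u = 2 * Real.pi * I * (u / (2 * Real.pi * I)) := by field_simp
  set s := u / (2 * Real.pi * I) with hs'
  have ha : Gamma (a + 1 + s) = (a + s) * Gamma (a + s) := by
    rw [add_right_comm]
    refine Gamma_add_one _ fun h => hu (Or.inr (Or.inl ⟨0, ?_⟩))
    rw [hs]; push_cast
    linear_combination 2 * Real.pi * I * h
  have hb : Gamma (b + 1 + s) = (b + s) * Gamma (b + s) := by
    rw [add_right_comm]
    refine Gamma_add_one _ fun h => hu (Or.inr (Or.inr ⟨0, ?_⟩))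
    rw [hs]; push_cast
    linear_combination 2 * Real.pi * I * h
  have hc : Gamma (c + 1 - s) = (c - s) * Gamma (c - s) := by
    rw [add_sub_right_comm]
    refine Gamma_add_one _ fun h => hu (Or.inl (Or.inl ⟨0, ?_⟩))
    rw [hs]; push_cast
    linear_combination -(2 * Real.pi * I * h)
  have hd : Gamma (d + 1 - s) = (d - s) * Gamma (d - s) := by
    rw [add_sub_right_comm]
    refine Gamma_add_one _ fun h => hu (Or.inl (Or.inr ⟨0, ?_⟩))
    rw [hs]; push_cast
    linear_combination -(2 * Real.pi * I * h)
  simp only [barnesFun, ← hs', ha, hb, hc, hd]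
  refine ⟨?_, ?_, ?_, ?_⟩ <;> ring

/-- The integral of `barnesFun a b c d` along a separating contour. -/
noncomputable def barnesIntegral (a b c d : ℂ) (h : ℝ) : ℂ :=
  separatingIntegral (barnesAbove c d) (barnesBelow a b) (barnesFun a b c d) h

/-- The contiguous relation of Barnes integrals. -/
theorem barnesIntegral_add_one (hUD : Disjoint (barnesAbove c d) (barnesBelow a b))
    (hh : ∀ p ∈ barnesAbove c d ∪ barnesBelow a b, p.im ≠ h) :
    (a + b + c + d) * barnesIntegral (a + 1) b c d h =
      (a + c) * (a + d) * barnesIntegral a b c d h := by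
  have hP := poleFamilies_barnes hUD
  have hf := decayingMeromorphic_barnesFun a b c d
  have hf1 := decayingMeromorphic_barnesFun (a + 1) b c d
  have hg := decayingMeromorphic_barnesFun a b (c + 1) (d + 1)
  have hgs := decayingMeromorphic_barnesFun (a + 1) (b + 1) c d
  have e1 : barnesIntegral (a + 1) b c d h = separatingIntegral (barnesAbove c d)
      (barnesBelow a b) (barnesFun (a + 1) b c d) h :=
    separatingIntegral_mono hUD subset_rfl (barnesBelow_add_one_left_subset a b) hf1
  have e2 : separatingIntegral (barnesAbove (c + 1) (d + 1)) (barnesBelow a b)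
      (barnesFun a b (c + 1) (d + 1)) h = separatingIntegral (barnesAbove c d)
      (barnesBelow a b) (barnesFun a b (c + 1) (d + 1)) h :=
    separatingIntegral_mono hUD (barnesAbove_add_one_subset c d) subset_rfl hg
  have e3 : separatingIntegral (barnesAbove c d) (barnesBelow (a + 1) (b + 1))
      (barnesFun (a + 1) (b + 1) c d) h = separatingIntegral (barnesAbove c d)
      (barnesBelow a b) (barnesFun (a + 1) (b + 1) c d) h :=
    separatingIntegral_mono hUD subset_rfl (barnesBelow_add_one_subset a b) hgs
  have e4 : separatingIntegral (barnesAbove c d) (barnesBelow (a + 1) (b + 1))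
      (barnesFun (a + 1) (b + 1) c d) h = separatingIntegral (barnesAbove (c + 1) (d + 1))
      (barnesBelow a b) (barnesFun a b (c + 1) (d + 1)) (h + 2 * Real.pi) := by
    rw [← separatingIntegral_comp_add_right (U := barnesAbove c d)
      (D := barnesBelow (a + 1) (b + 1)) (barnesFun a b (c + 1) (d + 1)) (2 * Real.pi)
      (fun z => add_two_pi_I_mem_barnesAbove) (fun z => add_two_pi_I_mem_barnesBelow)]
    congr 1
    ext z
    exact (barnesFun_add_two_pi_I a b c d z).symm
  -- The translated integral has its line at height h + 2π; contour independence brings it back to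
  -- h. A pole on the raised line would, translated down by 2πi, be a pole on the original one.
  have e5 : separatingIntegral (barnesAbove (c + 1) (d + 1)) (barnesBelow a b)
      (barnesFun a b (c + 1) (d + 1)) (h + 2 * Real.pi) =
      separatingIntegral (barnesAbove (c + 1) (d + 1)) (barnesBelow a b)
      (barnesFun a b (c + 1) (d + 1)) h := by
    refine separatingIntegral_eq (poleFamilies_barnes
      (hUD.mono_left (barnesAbove_add_one_subset c d))) hg (fun p hp hph => ?_)
      fun p hp => hh p (hp.imp_left fun h' => barnesAbove_add_one_subset c d h')
    refine hh (p - (2 * Real.pi : ℝ) * I) ?_ (by simp [hph])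
    rcases hp with hp | hp
    · left
      rw [← add_two_pi_I_mem_barnesAbove, sub_add_cancel]
      exact hp
    · right
      refine barnesBelow_add_one_subset a b ?_
      rw [← add_two_pi_I_mem_barnesBelow, sub_add_cancel]
      exact hp
  have hUg := hg.mono (union_subset_union_left (barnesBelow a b)
    (barnesAbove_add_one_subset c d))
  have hUgs := hgs.mono (union_subset_union_right (barnesAbove c d)
    (barnesBelow_add_one_subset a b))
  have hUf1 := hf1.mono (union_subset_union_right (barnesAbove c d)
    (barnesBelow_add_one_left_subset a b))
  -- This is the identity (a+b+c+d)(a+s) + (c-s)(d-s) = (a+c)(a+d) + (a+s)(b+s), multiplied by the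
  -- integrand. The second terms on both sides have equal integrals by the translation, and cancel.
  have key := separatingIntegral_congr hP ((hUf1.const_mul (a + b + c + d)).add hUg) hh
    (g := fun z => (a + c) * (a + d) * barnesFun a b c d z + barnesFun (a + 1) (b + 1) c d z)
    (fun z hz => by
      obtain ⟨h1, _, h3, h4⟩ := barnesFun_relations hz
      rw [h1, h3, h4]
      ring)
  rw [separatingIntegral_add hP (hUf1.const_mul _) hUg hh,
    separatingIntegral_add hP (hf.const_mul _) hUgs hh,
    separatingIntegral_const_mul hUf1, separatingIntegral_const_mul hf, ← e1, ← e2, ← e3, e4, e5]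
    at key
  exact add_right_cancel key

/-- The right hand side of the first Barnes lemma, in the variable `u = 2 π i s`. -/
noncomputable def barnesValue (a b c d : ℂ) : ℂ :=
  4 * Real.pi ^ 2 * (Gamma (a + c) * Gamma (a + d) * Gamma (b + c) * Gamma (b + d)) *
    (Gamma (a + b + c + d))⁻¹

/-- The first Barnes lemma holds for the parameters `a`, `b`, `c`, `d`. -/
def BarnesLemma (a b c d : ℂ) : Prop :=
  ∀ h : ℝ, (∀ p ∈ barnesAbove c d ∪ barnesBelow a b, p.im ≠ h) →
    barnesIntegral a b c d h = barnesValue a b c d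

/-- Disjointness of the poles makes (a + c)(a + d) nonzero, so the contiguous relation can be solved
for the integral at a. The recursion of 1/Γ, valid at every point, covers the case a + b + c + d =
0. -/
theorem BarnesLemma.of_add_one (hB : BarnesLemma (a + 1) b c d)
    (hUD : Disjoint (barnesAbove c d) (barnesBelow a b)) : BarnesLemma a b c d := by
  intro h hh
  have key := barnesIntegral_add_one hUD hh
  rw [hB h fun p hp => hh p (hp.imp_right fun h' => barnesBelow_add_one_left_subset a b h')] at key
  have hnd := disjoint_barnes_iff.1 hUD 0
  have hac : a + c ≠ 0 := by simpa using hnd.1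
  have had : a + d ≠ 0 := by simpa using hnd.2.1
  apply mul_left_cancel₀ (mul_ne_zero hac had)
  rw [← key]
  unfold barnesValue
  rw [one_div_Gamma_eq_self_mul_one_div_Gamma_add_one (a + b + c + d),
    show a + 1 + c = a + c + 1 by ring, show a + 1 + d = a + d + 1 by ring,
    show a + 1 + b + c + d = a + b + c + d + 1 by ring, Gamma_add_one _ hac, Gamma_add_one _ had]
  ring

theorem BarnesLemma.symm (hB : BarnesLemma a b c d) : BarnesLemma b a c d := by
  intro h hh
  have := hB h (by rwa [barnesBelow_comm])
  unfold barnesIntegral barnesValue at *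
  rw [barnesBelow_comm b a, barnesFun_comm_left b a, this, show b + a = a + b by ring]
  ring

theorem BarnesLemma.of_add_nat (n : ℕ) : ∀ a : ℂ, BarnesLemma (a + n) b c d →
    Disjoint (barnesAbove c d) (barnesBelow a b) → BarnesLemma a b c d := by
  induction n with
  | zero => intro a hB _; simpa using hB
  | succ n ih =>
    intro a hB hUD
    refine BarnesLemma.of_add_one (ih (a + 1) ?_
      (hUD.mono_right (barnesBelow_add_one_left_subset a b))) hUD
    convert hB using 1
    push_cast
    ring

theorem barnesBelow_add_nat_subset (a b : ℂ) (n : ℕ) :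
    barnesBelow (a + n) b ⊆ barnesBelow a b := by
  rintro u (⟨k, rfl⟩ | ⟨k, rfl⟩)
  · exact Or.inl ⟨n + k, by push_cast; ring⟩
  · exact Or.inr ⟨k, rfl⟩

/-- It suffices to prove the first Barnes lemma for parameters with positive real parts. -/
theorem barnesLemma_of_pos (H : ∀ a b c d : ℂ, 0 < (a + c).re → 0 < (a + d).re →
    0 < (b + c).re → 0 < (b + d).re → BarnesLemma a b c d)
    (hUD : Disjoint (barnesAbove c d) (barnesBelow a b)) : BarnesLemma a b c d := by
  -- Raising a by n and b by m makes all four sums a + c, a + d, b + c, b + d have positive real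
  -- part; the symmetry in a and b allows one parameter at a time.
  obtain ⟨n, hn⟩ := exists_nat_gt (max (-(a + c).re) (-(a + d).re))
  obtain ⟨m, hm⟩ := exists_nat_gt (max (-(b + c).re) (-(b + d).re))
  rw [max_lt_iff] at hn hm
  refine BarnesLemma.of_add_nat n a ?_ hUD
  refine (BarnesLemma.of_add_nat m b ?_ ?_).symm
  · simp only [add_re] at *
    apply H <;> simp only [add_re, natCast_re] <;> linarith
  · rw [barnesBelow_comm]
    exact hUD.mono_right (barnesBelow_add_nat_subset a b n)

end

open FourierTransform

/-! ### The first Barnes lemma -/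

/-- The integrand of the Beta integral `B(a, b)` in the variable `x` with `t = 1 / (1 + e⁻ˣ)`. -/
noncomputable def betaKernel (a b : ℂ) (x : ℝ) : ℂ :=
  (Real.sigmoid x : ℂ) ^ a * (1 - Real.sigmoid x : ℂ) ^ b

theorem one_sub_sigmoid_pos (x : ℝ) : 0 < 1 - Real.sigmoid x :=
  sub_pos.2 (Real.sigmoid_lt_one x)

theorem ofReal_sigmoid_ne_zero (x : ℝ) : (Real.sigmoid x : ℂ) ≠ 0 := by
  exact_mod_cast (Real.sigmoid_pos x).ne'

theorem one_sub_ofReal_sigmoid_ne_zero (x : ℝ) : (1 - Real.sigmoid x : ℂ) ≠ 0 := by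
  exact_mod_cast (one_sub_sigmoid_pos x).ne'

theorem betaKernel_mul (a b a' b' : ℂ) (x : ℝ) :
    betaKernel a b x * betaKernel a' b' x = betaKernel (a + a') (b + b') x := by
  unfold betaKernel
  rw [cpow_add _ _ (ofReal_sigmoid_ne_zero x), cpow_add _ _ (one_sub_ofReal_sigmoid_ne_zero x)]
  ring

theorem betaKernel_neg (a b : ℂ) (x : ℝ) : betaKernel a b (-x) = betaKernel b a x := by
  unfold betaKernel
  rw [Real.sigmoid_neg]
  push_cast
  rw [sub_sub_cancel, mul_comm]

/-- With σ the sigmoid, (1 - σ)/σ = e⁻ˣ. Exponentials are thus Beta kernels themselves, and the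
Fourier transform of a Beta kernel is a Beta integral with shifted parameters. -/
theorem betaKernel_neg_self (a : ℂ) (x : ℝ) : betaKernel (-a) a x = exp (-(a * x)) := by
  have h1 : Real.log (1 - Real.sigmoid x) = Real.log (Real.sigmoid x) - x := by
    rw [← Real.sigmoid_neg, ← Real.sigmoid_mul_rexp_neg,
      Real.log_mul (Real.sigmoid_pos x).ne' (Real.exp_ne_zero _), Real.log_exp]
    ring
  unfold betaKernel
  rw [cpow_def_of_ne_zero (ofReal_sigmoid_ne_zero x),
    cpow_def_of_ne_zero (one_sub_ofReal_sigmoid_ne_zero x), ← exp_add,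
    ← ofReal_log (Real.sigmoid_pos x).le]
  have h2 : log (1 - Real.sigmoid x : ℂ) = (Real.log (1 - Real.sigmoid x) : ℂ) := by
    rw [ofReal_log (one_sub_sigmoid_pos x).le]
    push_cast
    rfl
  rw [h2, h1]
  push_cast
  congr 1
  ring

theorem continuous_betaKernel (a b : ℂ) : Continuous (betaKernel a b) := by
  have hs : Continuous fun x : ℝ => (Real.sigmoid x : ℂ) :=
    continuous_ofReal.comp continuous_sigmoid
  refine (hs.cpow continuous_const fun x => ?_).mul
    ((continuous_const.sub hs).cpow continuous_const fun x => ?_)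
  · exact Or.inl (by simpa using Real.sigmoid_pos x)
  · exact Or.inl (by simpa using Real.sigmoid_lt_one x)

/-- The factor σ(1 - σ) is the Jacobian of the substitution by the sigmoid; it accounts for the
exponents a, b in place of a - 1, b - 1. -/
theorem betaKernel_eq_smul (a b : ℂ) (x : ℝ) : betaKernel a b x =
    |Real.sigmoid x * (1 - Real.sigmoid x)| •
      ((Real.sigmoid x : ℂ) ^ (a - 1) * (1 - (Real.sigmoid x : ℂ)) ^ (b - 1)) := by
  rw [abs_of_pos (mul_pos (Real.sigmoid_pos x) (one_sub_sigmoid_pos x)), real_smul]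
  unfold betaKernel
  have h1 := ofReal_sigmoid_ne_zero x
  have h2 := one_sub_ofReal_sigmoid_ne_zero x
  rw [cpow_sub _ _ h1, cpow_sub _ _ h2, cpow_one, cpow_one]
  push_cast
  field_simp

theorem integrable_betaKernel {a b : ℂ} (ha : 0 < a.re) (hb : 0 < b.re) :
    Integrable (betaKernel a b) := by
  have h := betaIntegral_convergent ha hb
  rw [intervalIntegrable_iff_integrableOn_Ioo_of_le zero_le_one, ← Real.range_sigmoid,
    ← image_univ, integrableOn_image_iff_integrableOn_abs_deriv_smul MeasurableSet.univ
      (fun x _ => (Real.hasDerivAt_sigmoid x).hasDerivWithinAt)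
      Real.sigmoid_injective.injOn, integrableOn_univ] at h
  exact h.congr (Eventually.of_forall fun x => (betaKernel_eq_smul a b x).symm)

theorem integral_betaKernel (a b : ℂ) : ∫ x, betaKernel a b x = betaIntegral a b := by
  unfold betaIntegral
  rw [intervalIntegral.integral_of_le zero_le_one, integral_Ioc_eq_integral_Ioo,
    ← Real.range_sigmoid, ← image_univ,
    integral_image_eq_integral_abs_deriv_smul MeasurableSet.univ
      (fun x _ => (Real.hasDerivAt_sigmoid x).hasDerivWithinAt)
      Real.sigmoid_injective.injOn, setIntegral_univ]
  simp_rw [betaKernel_eq_smul a b]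

theorem fourier_betaKernel (a b : ℂ) (w : ℝ) :
    𝓕 (betaKernel a b) w = betaIntegral (a - 2 * Real.pi * w * I) (b + 2 * Real.pi * w * I) := by
  rw [Real.fourier_real_eq_integral_exp_smul, ← integral_betaKernel]
  congr 1
  ext x
  rw [sub_eq_neg_add, add_comm b, ← betaKernel_mul, betaKernel_neg_self, smul_eq_mul]
  congr 2
  push_cast
  ring

theorem fourier_betaKernel_eq_Gamma {a b : ℂ} (ha : 0 < a.re) (hb : 0 < b.re) (w : ℝ) :
    𝓕 (betaKernel a b) w = Gamma (a - 2 * Real.pi * w * I) * Gamma (b + 2 * Real.pi * w * I) /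
      Gamma (a + b) := by
  rw [fourier_betaKernel, betaIntegral_eq_Gamma_mul_div _ _ (by simpa using ha)
    (by simpa using hb)]
  congr 2
  ring

theorem integrable_fourier_betaKernel {a b : ℂ} (ha : 0 < a.re) (hb : 0 < b.re) :
    Integrable (𝓕 (betaKernel a b)) := by
  have hr : (2 * Real.pi : ℝ) ≠ 0 := by positivity
  have hd := (stripDecay_Gamma_comp a (neg_ne_zero.2 hr)).mul (stripDecay_Gamma_comp b hr)
  have hG : ∀ (e : ℂ) (r : ℝ) (z : ℂ), 0 < e.re → z.im = 0 →
      ContinuousAt (fun u => Gamma (e + r * I * u)) z := by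
    intro e r z he hz
    have h1 : AnalyticAt ℂ Gamma (e + r * I * z) := by
      refine analyticAt_Gamma fun m hm => ?_
      have h2 := congrArg re hm
      simp [hz] at h2
      linarith [m.cast_nonneg (α := ℝ)]
    exact h1.continuousAt.comp (f := fun u => e + r * I * u) (by fun_prop)
  have := integrable_line (h := 0) hd fun z hz => (hG a _ z ha hz).mul (hG b _ z hb hz)
  refine (this.div_const (Gamma (a + b))).congr (Eventually.of_forall fun w => ?_)
  simp only [fourier_betaKernel_eq_Gamma ha hb]
  push_cast
  congr 3
  · ring
  · congr 1
    ring

theorem fourier_fourier_betaKernel {a b : ℂ} (ha : 0 < a.re) (hb : 0 < b.re) (x : ℝ) :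
    𝓕 (𝓕 (betaKernel a b)) x = betaKernel b a x := by
  have h := congrFun ((continuous_betaKernel a b).fourierInv_fourier_eq
    (integrable_betaKernel ha hb) (integrable_fourier_betaKernel ha hb)) (-x)
  rw [Real.fourierInv_eq_fourier_neg, neg_neg, betaKernel_neg] at h
  exact h

/-- The multiplication formula ∫ 𝓕f · g = ∫ f · 𝓕g with f = `betaKernel a c` and g = 𝓕(`betaKernel b
d`). The double transform swaps b and d, the product of the kernels is again a Beta kernel, and its
integral is B(a + d, c + b). -/
theorem integral_Gamma_mul_Gamma_mul_Gamma_mul_Gamma {a b c d : ℂ} (ha : 0 < a.re)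
    (hb : 0 < b.re) (hc : 0 < c.re) (hd : 0 < d.re) :
    ∫ w : ℝ, Gamma (a - 2 * Real.pi * w * I) * Gamma (b - 2 * Real.pi * w * I) *
      Gamma (c + 2 * Real.pi * w * I) * Gamma (d + 2 * Real.pi * w * I) =
      Gamma (a + c) * Gamma (a + d) * Gamma (b + c) * Gamma (b + d) *
        (Gamma (a + b + c + d))⁻¹ := by
  have key : ∫ w : ℝ, 𝓕 (betaKernel a c) w • 𝓕 (betaKernel b d) w =
      ∫ x : ℝ, betaKernel a c x • 𝓕 (𝓕 (betaKernel b d)) x := by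
    simpa using! (VectorFourier.integral_fourierIntegral_smul_eq_flip (L := innerₗ ℝ)
      Real.continuous_fourierChar continuous_inner (integrable_betaKernel ha hc)
      (integrable_fourier_betaKernel hb hd))
  have hac : Gamma (a + c) ≠ 0 := Gamma_ne_zero_of_re_pos (by simpa using add_pos ha hc)
  have hbd : Gamma (b + d) ≠ 0 := Gamma_ne_zero_of_re_pos (by simpa using add_pos hb hd)
  simp_rw [fourier_fourier_betaKernel hb hd, fourier_betaKernel_eq_Gamma ha hc,
    fourier_betaKernel_eq_Gamma hb hd, smul_eq_mul, betaKernel_mul] at key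
  rw [integral_betaKernel, betaIntegral_eq_Gamma_mul_div _ _ (by simpa using add_pos ha hd)
    (by simpa using add_pos hc hb)] at key
  rw [show a + d + (c + b) = a + b + c + d by ring, show c + b = b + c by ring] at key
  have hl : ∀ w : ℝ, Gamma (a - 2 * Real.pi * w * I) * Gamma (b - 2 * Real.pi * w * I) *
      Gamma (c + 2 * Real.pi * w * I) * Gamma (d + 2 * Real.pi * w * I) =
      (Gamma (a + c) * Gamma (b + d)) *
      (Gamma (a - 2 * Real.pi * w * I) * Gamma (c + 2 * Real.pi * w * I) / Gamma (a + c) *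
      (Gamma (b - 2 * Real.pi * w * I) * Gamma (d + 2 * Real.pi * w * I) / Gamma (b + d))) :=
    fun w => by field_simp
  simp_rw [hl]
  rw [integral_const_mul, key]
  ring

theorem barnesLemma_of_re_pos {a b c d : ℂ} (hac : 0 < (a + c).re) (had : 0 < (a + d).re)
    (hbc : 0 < (b + c).re) (hbd : 0 < (b + d).re) : BarnesLemma a b c d := by
  simp only [add_re] at hac had hbc hbd
  -- The line Re s = σ separates the two families, so no residue terms remain there.
  obtain ⟨σ, h1, h2⟩ : ∃ σ : ℝ, max (-a.re) (-b.re) < σ ∧ σ < min c.re d.re := by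
    apply exists_between
    rw [lt_min_iff, max_lt_iff, max_lt_iff]
    constructor <;> constructor <;> linarith
  rw [max_lt_iff] at h1
  rw [lt_min_iff] at h2
  have hpi : (0 : ℝ) < 2 * Real.pi := by positivity
  have hU : ∀ p ∈ barnesAbove c d, 2 * Real.pi * σ < p.im := by
    rintro p (⟨k, rfl⟩ | ⟨k, rfl⟩)
    · have : (2 * Real.pi * I * (c + k)).im = 2 * Real.pi * (c.re + k) := by simp
      rw [this]
      exact mul_lt_mul_of_pos_left (by linarith [k.cast_nonneg (α := ℝ)]) hpi
    · have : (2 * Real.pi * I * (d + k)).im = 2 * Real.pi * (d.re + k) := by simp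
      rw [this]
      exact mul_lt_mul_of_pos_left (by linarith [k.cast_nonneg (α := ℝ)]) hpi
  have hD : ∀ p ∈ barnesBelow a b, p.im < 2 * Real.pi * σ := by
    rintro p (⟨k, rfl⟩ | ⟨k, rfl⟩)
    · have : (-(2 * Real.pi * I * (a + k))).im = 2 * Real.pi * (-(a.re + k)) := by
        simp; ring
      rw [this]
      exact mul_lt_mul_of_pos_left (by linarith [k.cast_nonneg (α := ℝ)]) hpi
    · have : (-(2 * Real.pi * I * (b + k))).im = 2 * Real.pi * (-(b.re + k)) := by
        simp; ring
      rw [this]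
      exact mul_lt_mul_of_pos_left (by linarith [k.cast_nonneg (α := ℝ)]) hpi
  have hdisj : Disjoint (barnesAbove c d) (barnesBelow a b) :=
    Set.disjoint_left.2 fun p hp hp' => lt_asymm (hU p hp) (hD p hp')
  intro h hh
  unfold barnesIntegral
  rw [separatingIntegral_eq (h' := 2 * Real.pi * σ) (poleFamilies_barnes hdisj)
    (decayingMeromorphic_barnesFun a b c d) hh fun p hp =>
    hp.elim (fun hp => (hU p hp).ne') fun hp => (hD p hp).ne]
  unfold separatingIntegral
  have e1 : {p ∈ barnesAbove c d | p.im < 2 * Real.pi * σ} = ∅ := by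
    ext p
    simpa using fun hp => (hU p hp).le
  have e2 : {p ∈ barnesBelow a b | 2 * Real.pi * σ < p.im} = ∅ := by
    ext p
    simpa using fun hp => (hD p hp).le
  rw [e1, e2, finsum_mem_empty, add_zero, sub_zero]
  have key := integral_Gamma_mul_Gamma_mul_Gamma_mul_Gamma (a := a + σ) (b := b + σ)
    (c := c - σ) (d := d - σ) (by simp; linarith) (by simp; linarith) (by simp; linarith)
    (by simp; linarith)
  -- On this line s = σ - 2πiw with t = 4π²w, the source of the factor 4π² in `barnesValue`.
  have hline : ∀ t : ℝ, barnesFun a b c d (t + (2 * Real.pi * σ : ℝ) * I) =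
      (fun w : ℝ => Gamma (a + σ - 2 * Real.pi * w * I) * Gamma (b + σ - 2 * Real.pi * w * I) *
      Gamma (c - σ + 2 * Real.pi * w * I) * Gamma (d - σ + 2 * Real.pi * w * I))
        (t / (4 * Real.pi ^ 2)) := by
    intro t
    have h0 : (Real.pi : ℂ) ≠ 0 := by exact_mod_cast Real.pi_ne_zero
    have hs : ((t : ℂ) + (2 * Real.pi * σ : ℝ) * I) / (2 * Real.pi * I) =
        σ - 2 * Real.pi * (t / (4 * Real.pi ^ 2) : ℝ) * I := by
      push_cast
      field_simp
      linear_combination 4 * (t : ℂ) * I_sq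
    simp only [barnesFun, hs]
    rw [add_sub_assoc, add_sub_assoc, sub_add, sub_add]
  simp_rw [hline]
  rw [Measure.integral_comp_div (fun w : ℝ => Gamma (a + σ - 2 * Real.pi * w * I) *
    Gamma (b + σ - 2 * Real.pi * w * I) * Gamma (c - σ + 2 * Real.pi * w * I) *
    Gamma (d - σ + 2 * Real.pi * w * I)), key, abs_of_pos (by positivity), real_smul]
  unfold barnesValue
  push_cast
  rw [show a + σ + (c - σ) = a + c by ring, show a + σ + (d - σ) = a + d by ring,
    show b + σ + (c - σ) = b + c by ring, show b + σ + (d - σ) = b + d by ring,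
    show a + σ + (b + σ) + (c - σ) + (d - σ) = a + b + c + d by ring]
  ring

/-- **Barnes' first lemma** for contours that separate the two families of poles. -/
theorem barnesLemma {a b c d : ℂ} (hUD : Disjoint (barnesAbove c d) (barnesBelow a b)) :
    BarnesLemma a b c d :=
  barnesLemma_of_pos (fun _ _ _ _ => barnesLemma_of_re_pos) hUD

/-! ### The charge conjugation matrix -/

section

variable {N : ℕ}

theorem levi_eq_zero {f : Fin N → Fin N} (h : ¬ Function.Bijective f) : levi f = 0 :=
  dif_neg h

theorem levi_mul_self {f : Fin N → Fin N} (h : Function.Bijective f) : levi f * levi f = 1 := by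
  unfold levi
  rw [dif_pos h]
  norm_cast
  simp

theorem charge_eq_zero {ρ : Antiparticle N} {β : Fin N} (h : β ∈ range ρ) : charge ρ β = 0 := by
  obtain ⟨i, rfl⟩ := h
  refine levi_eq_zero fun hb => ?_
  have hi : i.val < N - 1 := i.isLt
  have := hb.1 (a₁ := ⟨i.val, by omega⟩) (a₂ := ⟨N - 1, by omega⟩) (by simp)
  simp at this
  omega

theorem charge_mul_self {ρ : Antiparticle N} {β : Fin N} (h : β ∉ range ρ) :
    charge ρ β * charge ρ β = 1 := by
  refine levi_mul_self (Finite.injective_iff_bijective.1 fun i j hij => ?_)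
  by_cases hi : i.val < N - 1 <;> by_cases hj : j.val < N - 1
  · simp only [hi, hj, dite_true] at hij
    have := congrArg Fin.val (ρ.injective hij)
    exact Fin.ext this
  · simp only [hi, hj, dite_true, dite_false] at hij
    exact absurd ⟨_, hij⟩ h
  · simp only [hi, hj, dite_true, dite_false] at hij
    exact absurd ⟨_, hij.symm⟩ h
  · exact Fin.ext (by omega)

theorem range_eq_compl_singleton {ρ : Antiparticle N} {β : Fin N} (h : β ∉ range ρ) :
    range ρ = {β}ᶜ := by
  refine Set.eq_of_subset_of_ncard_le (fun x hx hxβ => h (hxβ ▸ hx)) ?_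
  rw [Set.ncard_compl, Set.ncard_singleton, ← image_univ,
    Set.ncard_image_of_injective _ ρ.injective, Set.ncard_univ]
  simp

theorem mem_range_of_ne {ρ : Antiparticle N} {β γ : Fin N} (h : β ∉ range ρ) (hne : γ ≠ β) :
    γ ∈ range ρ := by
  rw [range_eq_compl_singleton h]
  exact hne

/-- An antiparticle is an increasing enumeration of the complement of a single index, and so is
determined by the index it misses. -/
theorem antiparticle_ext {ρ σ : Antiparticle N} {β : Fin N} (hρ : β ∉ range ρ)
    (hσ : β ∉ range σ) : ρ = σ := by
  have := (StrictMono.range_inj ρ.strictMono σ.strictMono).1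
    ((range_eq_compl_singleton hρ).trans (range_eq_compl_singleton hσ).symm)
  exact DFunLike.coe_injective this

theorem exists_antiparticle (β : Fin N) : ∃ ρ : Antiparticle N, β ∉ range ρ := by
  cases N with
  | zero => exact β.elim0
  | succ n => exact ⟨Fin.succAboveOrderEmb β, fun ⟨i, hi⟩ => Fin.succAbove_ne β i hi⟩

/-! ### The Bethe state -/

theorem mem_particleRange {j : ℕ} {α : Fin N} : α ∈ particleRange N j ↔ j ≤ α.val := by
  simp [particleRange]

theorem mem_antiparticleRange {j : ℕ} {ρ : Antiparticle N} :
    ρ ∈ antiparticleRange N j ↔ ∀ i : Fin N, i.val < j → i ∈ range ρ := by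
  simp [antiparticleRange]

/-- Only the antiparticle that misses α contributes, with sign squared 1; as α is not among the
first j indices, it belongs to the range of summation. -/
theorem sum_charge_mul_charge {j : ℕ} {α : Fin N} (h : j ≤ α.val) :
    ∑ ρ ∈ antiparticleRange N j, charge ρ α * charge ρ α = 1 := by
  obtain ⟨ρ, hρ⟩ := exists_antiparticle α
  rw [Finset.sum_eq_single_of_mem ρ, charge_mul_self hρ]
  · rw [mem_antiparticleRange]
    intro i hi
    refine mem_range_of_ne hρ ?_
    rintro rfl
    omega
  · intro σ _ hne
    have : α ∈ range σ := by
      by_contra h'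
      exact hne (antiparticle_ext h' hρ)
    rw [charge_eq_zero this, zero_mul]

variable (N) in
/-- The factor of level `i` in the Bethe state with external particle `a`. -/
noncomputable def levelWeight (ω : ℂ) (a i : ℕ) (z u : ℂ) : ℂ :=
  (if i = a then 0 else cTilde N (z - u)) +
    if i < a then 0 else bTilde N (z - u) * dTilde N (ω - u)

theorem levelWeight_of_lt {ω : ℂ} {a i : ℕ} (h : i < a) (z u : ℂ) :
    levelWeight N ω a i z u = cTilde N (z - u) := by
  simp [levelWeight, h, h.ne]

theorem levelWeight_self (ω : ℂ) (a : ℕ) (z u : ℂ) :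
    levelWeight N ω a a z u = bTilde N (z - u) * dTilde N (ω - u) := by
  simp [levelWeight]

theorem levelWeight_of_gt {ω : ℂ} {a i : ℕ} (h : a < i) (z u : ℂ) :
    levelWeight N ω a i z u = cTilde N (z - u) + bTilde N (z - u) * dTilde N (ω - u) := by
  simp [levelWeight, h.ne', h.not_gt]

/-- At level j the particle j contributes `bTilde * dTilde` and every later one `cTilde`; the
remaining levels give the same product in both cases, by induction, so the sum factorises. -/
theorem sum_prod_levelWeight (ω : ℂ) (z : ℕ → ℂ) (k : ℕ) : ∀ j, k + j + 1 = N →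
    ∑ α ∈ particleRange N j, ∏ i ∈ Finset.Ico j (N - 1),
      levelWeight N ω α.val i (z i) (z (i + 1)) =
    ∏ i ∈ Finset.Ico j (N - 1), (cTilde N (z i - z (i + 1)) +
      bTilde N (z i - z (i + 1)) * dTilde N (ω - z (i + 1))) := by
  induction k with
  | zero =>
    intro j hj
    have : particleRange N j = {⟨j, by omega⟩} := by
      ext α
      rw [mem_particleRange, Finset.mem_singleton, Fin.ext_iff]
      have := α.isLt
      simp only
      omega
    rw [Finset.Ico_eq_empty (by omega)]
    simp [this]
  | succ k ih =>
    intro j hj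
    have hins : particleRange N j = insert ⟨j, by omega⟩ (particleRange N (j + 1)) := by
      ext α
      rw [mem_particleRange, Finset.mem_insert, mem_particleRange, Fin.ext_iff]
      simp only
      omega
    rw [hins, Finset.sum_insert (by rw [mem_particleRange]; simp)]
    have hbot := fun f : ℕ → ℂ => Finset.prod_eq_prod_Ico_succ_bot (show j < N - 1 by omega) f
    simp only [hbot]
    have hsum : ∑ α ∈ particleRange N (j + 1), levelWeight N ω α.val j (z j) (z (j + 1)) *
        ∏ i ∈ Finset.Ico (j + 1) (N - 1), levelWeight N ω α.val i (z i) (z (i + 1)) =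
        cTilde N (z j - z (j + 1)) * ∑ α ∈ particleRange N (j + 1),
          ∏ i ∈ Finset.Ico (j + 1) (N - 1), levelWeight N ω α.val i (z i) (z (i + 1)) := by
      rw [Finset.mul_sum]
      exact Finset.sum_congr rfl fun α hα => by
        rw [levelWeight_of_lt (show j < α.val from mem_particleRange.1 hα)]
    rw [hsum, levelWeight_self, Finset.prod_congr rfl fun i hi =>
      levelWeight_of_gt (show j < i from (Finset.mem_Ico.1 hi).1) _ _, ih (j + 1) (by omega)]
    ring

/-- Only γ = α' and γ = s survive in the auxiliary sum. The first meets only the annihilation term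
because s ≠ α', the second only the identity term because ρ' contains s. -/
theorem monodromy_eq {s : Fin N} {z ω u : ℂ} {α α' : Fin N} {ρ ρ' : Antiparticle N}
    (hα' : s ≠ α') (hρ' : s ∈ range ρ') :
    monodromy N s z ω u α ρ α' ρ' =
      (if α = s then bTilde N (z - u) * (dTilde N (ω - u) * charge ρ' α' * charge ρ s) else 0) +
      if α = α' then (if ρ = ρ' then cTilde N (z - u) else 0) else 0 := by
  classical
  have hs : ∀ (z : ℂ) (γ : Fin N), sTilde N z α γ α' s =
      (if γ = α' then (if α = s then bTilde N z else 0) else 0) +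
      if γ = s then (if α = α' then cTilde N z else 0) else 0 := fun z γ => by
    unfold sTilde
    congr 1 <;> split_ifs <;> tauto
  unfold monodromy
  simp only [hs, add_mul, Finset.sum_add_distrib, ite_mul, zero_mul, Finset.sum_ite_eq',
    Finset.mem_univ, if_true]
  unfold sBarTilde
  simp only [hα', and_false, if_false, and_true, charge_eq_zero hρ', mul_zero, zero_mul, add_zero,
    zero_add, mul_ite, mul_one]

theorem charge_top {ρ : Antiparticle N} {α : Fin N} (hα : α.val = N - 1)
    (hρ : ∀ i, (ρ i).val = i.val) : charge ρ α = 1 := by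
  have hf : (fun i : Fin N => if h : i.val < N - 1 then ρ ⟨i.val, h⟩ else α) = id := by
    ext i
    by_cases h : i.val < N - 1
    · simp [h, hρ]
    · simp [h, hα]
      omega
  unfold charge
  rw [hf]
  unfold levi
  rw [dif_pos Function.bijective_id]
  have : Equiv.ofBijective (id : Fin N → Fin N) Function.bijective_id = Equiv.refl _ := by
    ext; rfl
  rw [this]
  simp

theorem antiparticle_apply_eq {ρ : Antiparticle N} (h : ρ ∈ antiparticleRange N (N - 1))
    (i : Fin (N - 1)) : (ρ i).val = i.val := by
  have hi := i.isLt
  have htop : (⟨N - 1, by omega⟩ : Fin N) ∉ range ρ := by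
    intro htop
    have hall : Function.Surjective ρ := fun β => by
      by_cases hβ : β.val < N - 1
      · exact mem_antiparticleRange.1 h β hβ
      · have : β = ⟨N - 1, by omega⟩ := Fin.ext (by have := β.isLt; simp only; omega)
        rw [this]
        exact htop
    have := Fintype.card_le_of_surjective ρ hall
    simp at this
    omega
  have hcast : (⟨N - 1, by omega⟩ : Fin N) ∉
      range (Fin.castLEOrderEmb (Nat.sub_le N 1) : Fin (N - 1) ↪o Fin N) := by
    rintro ⟨x, hx⟩
    have h1 := congrArg Fin.val hx
    simp at h1
    have := x.isLt
    omega
  rw [antiparticle_ext htop hcast]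
  rfl

theorem betheFrom_eq (ω : ℂ) (z : ℕ → ℂ) (k : ℕ) : ∀ (j : ℕ) (α : Fin N) (ρ : Antiparticle N),
    k + j + 1 = N → j ≤ α.val → ρ ∈ antiparticleRange N j →
    betheFrom N ω z k j α ρ = charge ρ α * ∏ i ∈ Finset.Ico j (N - 1),
      levelWeight N ω α.val i (z i) (z (i + 1)) := by
  classical
  induction k with
  | zero =>
    intro j α ρ hj hα hρ
    have hj' : j = N - 1 := by omega
    subst hj'
    have hα' : α.val = N - 1 := by have := α.isLt; omega
    have hρ' := antiparticle_apply_eq hρ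
    unfold betheFrom
    rw [if_pos ⟨hα', hρ'⟩, charge_top hα' hρ', Finset.Ico_self, Finset.prod_empty, mul_one]
  | succ k ih =>
    intro j α ρ hj hα hρ
    unfold betheFrom
    rw [dif_pos (show j < N by omega)]
    set s : Fin N := ⟨j, by omega⟩ with hs
    set P : Fin N → ℂ := fun α' => ∏ i ∈ Finset.Ico (j + 1) (N - 1),
      levelWeight N ω α'.val i (z i) (z (i + 1)) with hP
    have hterm : ∀ α' ∈ particleRange N (j + 1), ∀ ρ' ∈ antiparticleRange N (j + 1),
        betheFrom N ω z k (j + 1) α' ρ' * monodromy N s (z j) ω (z (j + 1)) α ρ α' ρ' =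
        (if α = s then bTilde N (z j - z (j + 1)) * dTilde N (ω - z (j + 1)) * charge ρ s *
          P α' * (charge ρ' α' * charge ρ' α') else 0) +
        if α = α' then (if ρ = ρ' then cTilde N (z j - z (j + 1)) * charge ρ' α' * P α' else 0)
          else 0 := by
      intro α' hα' ρ' hρ'
      rw [mem_particleRange] at hα'
      rw [ih (j + 1) α' ρ' (by omega) hα' hρ', monodromy_eq]
      · split_ifs <;> ring
      · intro h
        rw [← h] at hα'
        simp [hs] at hα'
      · exact mem_antiparticleRange.1 hρ' s (by simp [hs])
    rw [Finset.sum_congr rfl fun α' hα' => Finset.sum_congr rfl (hterm α' hα')]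
    simp only [Finset.sum_add_distrib]
    rw [Finset.prod_eq_prod_Ico_succ_bot (show j < N - 1 by omega)]
    -- If α is the reference index, the pair is annihilated and recreated with every (α', ρ'), and
    -- the two preceding sums apply. Otherwise the particle and the antiparticle pass unchanged.
    rcases hα.eq_or_lt with hαj | hαj
    · have hαs : α = s := Fin.ext hαj.symm
      have h2 : ∀ α' ∈ particleRange N (j + 1), α ≠ α' := by
        rintro α' hα' rfl
        rw [mem_particleRange] at hα'
        omega
      rw [Finset.sum_congr (g := fun _ => (0 : ℂ)) (s₁ := particleRange N (j + 1)) rfl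
        (f := fun α' => ∑ ρ' ∈ antiparticleRange N (j + 1), if α = α' then _ else 0)
        fun α' hα' => by simp [h2 α' hα']]
      simp only [hαs, if_true, Finset.sum_const_zero, add_zero]
      simp only [← Finset.mul_sum]
      rw [Finset.sum_congr rfl fun α' hα' => by
        rw [sum_charge_mul_charge (mem_particleRange.1 hα'), mul_one], ← Finset.mul_sum,
        sum_prod_levelWeight ω z k (j + 1) (by omega)]
      have hsv : s.val = j := rfl
      rw [hsv, levelWeight_self, Finset.prod_congr rfl fun i hi =>
        levelWeight_of_gt (show j < i from (Finset.mem_Ico.1 hi).1) _ _]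
      ring
    · have hαs : α ≠ s := fun h => by rw [h] at hαj; exact lt_irrefl _ hαj
      simp only [hαs, if_false, Finset.sum_const_zero, zero_add]
      rw [Finset.sum_eq_single_of_mem α (mem_particleRange.2 hαj)
        (fun β _ hβ => by simp [hβ.symm])]
      simp only [if_true]
      rw [Finset.sum_ite_eq, levelWeight_of_lt hαj]
      split_ifs with hρ'
      · ring
      -- If ρ leaves the summation range it misses s, hence contains α, and the right-hand side
      -- vanishes too.
      · have hsρ : s ∉ range ρ := fun hsρ => hρ' (mem_antiparticleRange.2 fun i hi => by
          rcases Nat.lt_succ_iff_lt_or_eq.1 hi with h | h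
          · exact mem_antiparticleRange.1 hρ i h
          · rwa [show i = s from Fin.ext h])
        rw [charge_eq_zero (mem_range_of_ne hsρ hαs), zero_mul]

theorem integrand_eq (hN : 1 ≤ N) (ω : ℂ) (α : Fin N) (δ : Antiparticle N) (z : ℕ → ℂ) :
    integrand N ω α δ z = charge δ α * (∏ i ∈ Finset.range (N - 1),
      phiTilde N (z i - z (i + 1)) * levelWeight N ω α.val i (z i) (z (i + 1))) *
      chiTilde N (ω - z (N - 1)) := by
  unfold integrand hTilde betheState
  rw [betheFrom_eq ω z (N - 1) 0 α δ (by omega) (Nat.zero_le _)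
    (mem_antiparticleRange.2 fun i hi => absurd hi (Nat.not_lt_zero _)), Finset.prod_mul_distrib,
    Nat.Ico_zero_eq_range]
  ring

end

/-! ### The integral of one level -/

section

variable {N : ℕ}

theorem polesAbove_eq (hN : N ≠ 0) (ω z : ℂ) : polesAbove N ω z =
    barnesAbove (z / (2 * Real.pi * I) - 1 / N) (ω / (2 * Real.pi * I) - 1 / 2) := by
  have hN' : (N : ℂ) ≠ 0 := by exact_mod_cast hN
  have hpi : (Real.pi : ℂ) ≠ 0 := by exact_mod_cast Real.pi_ne_zero
  have h1 : ∀ k : ℕ, z - I * eta N + 2 * Real.pi * I * k =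
      2 * Real.pi * I * (z / (2 * Real.pi * I) - 1 / N + k) := fun k => by
    unfold eta
    field_simp
  have h2 : ∀ k : ℕ, ω - I * Real.pi + 2 * Real.pi * I * k =
      2 * Real.pi * I * (ω / (2 * Real.pi * I) - 1 / 2 + k) := fun k => by
    field_simp
  simp only [polesAbove, barnesAbove, h1, h2]

theorem polesBelow_eq (hN : N ≠ 0) (ω z : ℂ) (j : ℕ) : polesBelow N ω j z =
    barnesBelow (-(z / (2 * Real.pi * I)))
      ((j + 1) / N - 1 / 2 - ω / (2 * Real.pi * I)) := by
  have hN' : (N : ℂ) ≠ 0 := by exact_mod_cast hN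
  have hpi : (Real.pi : ℂ) ≠ 0 := by exact_mod_cast Real.pi_ne_zero
  have h1 : ∀ k : ℕ, z - 2 * Real.pi * I * k =
      -(2 * Real.pi * I * (-(z / (2 * Real.pi * I)) + k)) := fun k => by
    field_simp
    ring
  have h2 : ∀ k : ℕ, ω + I * Real.pi - I * eta N * (j + 1) - 2 * Real.pi * I * k =
      -(2 * Real.pi * I * ((j + 1) / N - 1 / 2 - ω / (2 * Real.pi * I) + k)) := fun k => by
    unfold eta
    field_simp
    ring
  simp only [polesBelow, barnesBelow, h1, h2]

/-- The two families of poles of level `j` collide only at points of the second families of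
level `j - 1`. -/
theorem disjoint_poles {ω z : ℂ} {j : ℕ} (hj : j + 1 < N)
    (h1 : ∀ k : ℕ, z ≠ ω - I * Real.pi + 2 * Real.pi * I * k)
    (h2 : ∀ k : ℕ, z ≠ ω + I * Real.pi - I * eta N * j - 2 * Real.pi * I * k) :
    Disjoint (polesAbove N ω z) (polesBelow N ω j z) := by
  have hN : N ≠ 0 := by omega
  have hN' : (N : ℂ) ≠ 0 := by exact_mod_cast hN
  have hpi : (Real.pi : ℂ) ≠ 0 := by exact_mod_cast Real.pi_ne_zero
  rw [polesAbove_eq hN, polesBelow_eq hN, disjoint_barnes_iff]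
  refine fun k => ⟨fun h => ?_, fun h => h1 k ?_, fun h => h2 k ?_, fun h => ?_⟩
  · have h3 : ((k * N : ℕ) : ℂ) = (1 : ℕ) := by
      push_cast
      rw [neg_add_eq_sub, sub_sub_cancel_left, neg_inj] at h
      field_simp at h
      linear_combination -h
    rw [Nat.cast_inj, mul_eq_one] at h3
    omega
  · field_simp at h
    linear_combination -h
  · unfold eta
    field_simp at h ⊢
    linear_combination h
  · have h3 : ((k * N + (j + 1) : ℕ) : ℂ) = N := by
      push_cast
      rw [show (j + 1 : ℂ) / N - 1 / 2 - ω / (2 * Real.pi * I) +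
        (ω / (2 * Real.pi * I) - 1 / 2) = (j + 1) / N - 1 by ring] at h
      field_simp at h
      linear_combination h
    rw [Nat.cast_inj] at h3
    rcases k with _ | k
    · omega
    · rw [Nat.succ_mul] at h3
      omega

variable (N) in
/-- The function of `ω` that remains after the integration over the levels `j, …, N - 2`. -/
noncomputable def chiLevel (j : ℕ) (ω : ℂ) : ℂ :=
  Gamma (1 / 2 + ω / (2 * Real.pi * I)) * Gamma (j / N - 1 / 2 - ω / (2 * Real.pi * I))

theorem chiTilde_eq_chiLevel (hN : 1 ≤ N) (ω : ℂ) : chiTilde N ω = chiLevel N (N - 1) ω := by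
  have hN' : (N : ℂ) ≠ 0 := by exact_mod_cast (by omega : N ≠ 0)
  unfold chiTilde chiLevel
  congr 2
  rw [Nat.cast_sub hN]
  push_cast
  field_simp
  ring

variable (N) in
/-- The integrand of level `j` after the integration over the higher levels. -/
noncomputable def levelIntegrand (ω : ℂ) (a j : ℕ) (z u : ℂ) : ℂ :=
  phiTilde N (z - u) * levelWeight N ω a j z u * chiLevel N (j + 1) (ω - u)

variable (N) in
/-- The constant produced by the integration over level `j`. -/
noncomputable def levelConst (a j : ℕ) : ℂ :=
  -(1 / N) * (4 * Real.pi ^ 2) *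
    ((if j = a then 0 else Gamma (-(1 / N)) * Gamma ((j + 1) / N)) +
      if j < a then 0 else Gamma (1 - 1 / N) * Gamma ((j + 1) / N - 1)) * (Gamma (j / N))⁻¹

/-- The conventions `Gamma 0 = 0` and `0⁻¹ = 0` agree here with the genuine zero of the entire
function 1/Γ at 0; this zero is the reason for the vanishing of K. -/
theorem levelConst_zero (a : ℕ) : levelConst N a 0 = 0 := by
  simp [levelConst, Gamma_zero]

/-- The denominators of `bTilde`, `cTilde` and `dTilde` are absorbed by the recursion of Γ in
`phiTilde` and `chiLevel`, and the numerator of `bTilde` raises the first parameter by 1. The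
`cTilde` part keeps the last parameter raised; both parts have constant -1/N. -/
theorem levelIntegrand_eq (hN : N ≠ 0) {ω z u : ℂ} {a j : ℕ}
    (hu : u ∉ polesAbove N ω z ∪ polesBelow N ω j z) :
    levelIntegrand N ω a j z u = (if j = a then 0 else -(1 / N : ℂ)) *
      barnesFun (-(z / (2 * Real.pi * I))) ((j + 1) / N - 1 / 2 - ω / (2 * Real.pi * I))
        (z / (2 * Real.pi * I) - 1 / N) (ω / (2 * Real.pi * I) - 1 / 2 + 1) u +
      (if j < a then 0 else -(1 / N : ℂ)) *
      barnesFun (-(z / (2 * Real.pi * I)) + 1) ((j + 1) / N - 1 / 2 - ω / (2 * Real.pi * I))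
        (z / (2 * Real.pi * I) - 1 / N) (ω / (2 * Real.pi * I) - 1 / 2) u := by
  have hN' : (N : ℂ) ≠ 0 := by exact_mod_cast hN
  have hpi : (Real.pi : ℂ) ≠ 0 := by exact_mod_cast Real.pi_ne_zero
  rw [polesAbove_eq hN, polesBelow_eq hN] at hu
  obtain ⟨r1, r2, -, -⟩ := barnesFun_relations hu
  rw [r1, r2]
  have hc0 : z / (2 * Real.pi * I) - 1 / N - u / (2 * Real.pi * I) ≠ 0 := fun h =>
    hu (Or.inl (Or.inl ⟨0, by field_simp at h ⊢; push_cast; linear_combination -h⟩))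
  have hd0 : ω / (2 * Real.pi * I) - 1 / 2 - u / (2 * Real.pi * I) ≠ 0 := fun h =>
    hu (Or.inl (Or.inr ⟨0, by field_simp at h ⊢; push_cast; linear_combination -h⟩))
  have hs : u = 2 * Real.pi * I * (u / (2 * Real.pi * I)) := by field_simp
  unfold levelIntegrand levelWeight phiTilde chiLevel
  rw [sub_div z u, sub_div ω u]
  have hb : bTilde N (z - u) = (z / (2 * Real.pi * I) - u / (2 * Real.pi * I)) /
      (z / (2 * Real.pi * I) - 1 / N - u / (2 * Real.pi * I)) := by
    have e : z - u - I * eta N = 2 * Real.pi * I *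
        (z / (2 * Real.pi * I) - 1 / N - u / (2 * Real.pi * I)) := by
      unfold eta
      field_simp
      ring
    unfold bTilde
    rw [e, div_eq_div_iff (mul_ne_zero two_pi_I_ne_zero' hc0) hc0]
    rw [← mul_assoc]
    congr 1
    field_simp
  have hc : cTilde N (z - u) = -(1 / N) /
      (z / (2 * Real.pi * I) - 1 / N - u / (2 * Real.pi * I)) := by
    have e : z - u - I * eta N = 2 * Real.pi * I *
        (z / (2 * Real.pi * I) - 1 / N - u / (2 * Real.pi * I)) := by
      unfold eta
      field_simp
      ring
    unfold cTilde
    rw [e, div_eq_div_iff (mul_ne_zero two_pi_I_ne_zero' hc0) hc0, ← mul_assoc]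
    congr 1
    unfold eta
    field_simp
  have hd : dTilde N (ω - u) = (1 / N) /
      (ω / (2 * Real.pi * I) - 1 / 2 - u / (2 * Real.pi * I)) := by
    have e : I * Real.pi - (ω - u) = 2 * Real.pi * I *
        -(ω / (2 * Real.pi * I) - 1 / 2 - u / (2 * Real.pi * I)) := by
      field_simp
      ring
    unfold dTilde
    rw [e, div_eq_div_iff (mul_ne_zero two_pi_I_ne_zero' (neg_ne_zero.2 hd0)) hd0, ← mul_assoc,
      mul_neg, neg_mul, neg_inj]
    congr 1
    unfold eta
    field_simp
  rw [hb, hc, hd]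
  generalize z / (2 * Real.pi * I) = y at *
  generalize ω / (2 * Real.pi * I) = w at *
  generalize hsu : u / (2 * Real.pi * I) = s at *
  have g1 : Gamma (1 - 1 / N + (y - s)) = (y - 1 / N - s) * Gamma (y - 1 / N - s) := by
    rw [← Gamma_add_one _ hc0]
    congr 1
    ring
  have g2 : Gamma (1 / 2 + (w - s)) = (w - 1 / 2 - s) * Gamma (w - 1 / 2 - s) := by
    rw [← Gamma_add_one _ hd0]
    congr 1
    ring
  have g3 : ((j + 1 : ℕ) : ℂ) / N - 1 / 2 - (w - s) = (j + 1) / N - 1 / 2 - w + s := by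
    push_cast
    ring
  simp only [barnesFun, hsu]
  rw [g1, g2, g3, show -(y - s) = -y + s by ring, show y - s = -(-y + s) by ring]
  generalize y - 1 / N - s = P at *
  generalize w - 1 / 2 - s = Q at *
  generalize Gamma (-y + s) = G₁
  generalize Gamma ((j + 1) / N - 1 / 2 - w + s) = G₂
  split_ifs <;> field_simp <;> ring

theorem barnesIntegral_eq_of_separates {C : Contour} {a b c d a' d' : ℂ}
    (hC : C.Separates (barnesAbove c d) (barnesBelow a b))
    (hU : barnesAbove c d' ⊆ barnesAbove c d) (hD : barnesBelow a' b ⊆ barnesBelow a b) :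
    separatingIntegral (barnesAbove c d) (barnesBelow a b) (barnesFun a' b c d') C.height =
      barnesValue a' b c d' := by
  rw [← separatingIntegral_mono hC.disjoint hU hD (decayingMeromorphic_barnesFun a' b c d')]
  exact barnesLemma (hC.disjoint.mono hU hD) C.height fun p hp =>
    hC.line p (hp.imp (fun h => hU h) fun h => hD h)

theorem level_integral (hN : N ≠ 0) {C : Contour} {ω z : ℂ} {a j : ℕ}
    (hC : C.Separates (polesAbove N ω z) (polesBelow N ω j z)) :
    C.Integrable (levelIntegrand N ω a j z) ∧
      C.integral (levelIntegrand N ω a j z) = levelConst N a j * chiLevel N j (ω - z) := by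
  have heq : ∀ u ∈ C.points, levelIntegrand N ω a j z u = _ := fun u hu =>
    levelIntegrand_eq (a := a) hN (hC.notMem_of_mem_points hu)
  rw [polesAbove_eq hN, polesBelow_eq hN] at hC
  generalize hA : -(z / (2 * Real.pi * I)) = A at *
  generalize hB : (j + 1 : ℂ) / N - 1 / 2 - ω / (2 * Real.pi * I) = B at *
  generalize hc : z / (2 * Real.pi * I) - 1 / N = c at *
  generalize hd : ω / (2 * Real.pi * I) - 1 / 2 = d at *
  have hU := barnesAbove_add_one_right_subset c d
  have hD := barnesBelow_add_one_left_subset A B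
  have hf1 := ((decayingMeromorphic_barnesFun A B c (d + 1)).mono
    (union_subset_union_left (barnesBelow A B) hU))
  have hf2 := ((decayingMeromorphic_barnesFun (A + 1) B c d).mono
    (union_subset_union_right (barnesAbove c d) hD))
  have hf := (hf1.const_mul (if j = a then 0 else -(1 / N : ℂ))).add
    (hf2.const_mul (if j < a then 0 else -(1 / N : ℂ)))
  refine ⟨(hC.integrable hf).congr hC.radius_pos.le fun u hu => (heq u hu).symm, ?_⟩
  rw [Contour.integral_congr hC.radius_pos.le heq, hC.integral_eq hf,
    separatingIntegral_add (poleFamilies_barnes hC.disjoint) (hf1.const_mul _) (hf2.const_mul _)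
      hC.line, separatingIntegral_const_mul hf1, separatingIntegral_const_mul hf2,
    barnesIntegral_eq_of_separates hC hU subset_rfl,
    barnesIntegral_eq_of_separates hC subset_rfl hD]
  unfold barnesValue levelConst chiLevel
  subst hA hB hc hd
  rw [sub_div ω z]
  generalize z / (2 * Real.pi * I) = y
  generalize ω / (2 * Real.pi * I) = w
  -- In both Barnes values the two Γ factors depending on ω - z form `chiLevel N j (ω - z)`; the
  -- others are constants, and the parameters sum to j/N.
  rw [show -y + (y - 1 / N) = -(1 / (N : ℂ)) by ring,
    show -y + (w - 1 / 2 + 1) = 1 / 2 + (w - y) by ring,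
    show (j + 1 : ℂ) / N - 1 / 2 - w + (y - 1 / N) = j / N - 1 / 2 - (w - y) by ring,
    show (j + 1 : ℂ) / N - 1 / 2 - w + (w - 1 / 2 + 1) = (j + 1) / N by ring,
    show -y + ((j + 1 : ℂ) / N - 1 / 2 - w) + (y - 1 / N) + (w - 1 / 2 + 1) = j / N by ring,
    show -y + 1 + (y - 1 / N) = 1 - 1 / (N : ℂ) by ring,
    show -y + 1 + (w - 1 / 2) = 1 / 2 + (w - y) by ring,
    show (j + 1 : ℂ) / N - 1 / 2 - w + (w - 1 / 2) = (j + 1) / N - 1 by ring,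
    show -y + 1 + ((j + 1 : ℂ) / N - 1 / 2 - w) + (y - 1 / N) + (w - 1 / 2) = j / N by ring]
  split_ifs <;> ring

end

/-! ### Existence of contours -/

section

variable {N : ℕ}

theorem exists_le_norm_add_intCast (e : ℂ) :
    ∃ r : ℝ, 0 < r ∧ ∀ n : ℤ, e + n ≠ 0 → r ≤ ‖e + n‖ := by
  by_cases him : e.im = 0
  · have hnorm : ∀ n : ℤ, ‖e + n‖ = |e.re + n| := fun n => by
      have : e + n = ((e.re + n : ℝ) : ℂ) := by apply Complex.ext <;> simp [him]
      rw [this, norm_real, Real.norm_eq_abs]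
    by_cases hre : e.re = round e.re
    · refine ⟨1, one_pos, fun n hn => ?_⟩
      rw [← norm_ne_zero_iff, hnorm, hre] at hn
      rw [hnorm, hre]
      norm_cast at hn ⊢
      exact Int.one_le_abs (abs_ne_zero.1 hn)
    · refine ⟨|e.re - round e.re|, abs_pos.2 (sub_ne_zero.2 hre), fun n _ => ?_⟩
      have := round_le e.re (-n)
      rw [hnorm]
      simpa using this
  · refine ⟨|e.im|, abs_pos.2 him, fun n _ => ?_⟩
    simpa using abs_im_le_norm (e + n)

theorem exists_le_norm_add_intCast_of_finset (T : Finset ℂ) :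
    ∃ r : ℝ, 0 < r ∧ ∀ e ∈ T, ∀ n : ℤ, e + n ≠ 0 → r ≤ ‖e + n‖ := by
  classical
  induction T using Finset.induction_on with
  | empty => exact ⟨1, one_pos, by simp⟩
  | insert e T _ ih =>
    obtain ⟨r, hr, h⟩ := ih
    obtain ⟨s, hs, h'⟩ := exists_le_norm_add_intCast e
    refine ⟨min r s, lt_min hr hs, fun e' he' n hn => ?_⟩
    rcases Finset.mem_insert.1 he' with rfl | he'
    · exact (min_le_right _ _).trans (h' n hn)
    · exact (min_le_left _ _).trans (h e' he' n hn)

theorem mem_progression_of_mem_barnes {a b c d p : ℂ}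
    (hp : p ∈ barnesAbove c d ∪ barnesBelow a b) :
    ∃ e ∈ ({c, d, -a, -b} : Finset ℂ), ∃ n : ℤ, p = 2 * Real.pi * I * (e + n) := by
  rcases hp with (⟨k, rfl⟩ | ⟨k, rfl⟩) | (⟨k, rfl⟩ | ⟨k, rfl⟩)
  · exact ⟨c, by simp, k, by push_cast; ring⟩
  · exact ⟨d, by simp, k, by push_cast; ring⟩
  · exact ⟨-a, by simp, -k, by push_cast; ring⟩
  · exact ⟨-b, by simp, -k, by push_cast; ring⟩

/-- All poles lie in four cosets of 2πiℤ, so their differences lie in finitely many cosets, each of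
which has its nonzero elements bounded away from 0. This gives one admissible radius for all
circles. -/
theorem exists_lt_dist_barnes (a b c d : ℂ) : ∃ r : ℝ, 0 < r ∧
    ∀ p ∈ barnesAbove c d ∪ barnesBelow a b, ∀ q ∈ barnesAbove c d ∪ barnesBelow a b,
      p ≠ q → r < dist p q := by
  obtain ⟨r, hr, h⟩ := exists_le_norm_add_intCast_of_finset
    (({c, d, -a, -b} ×ˢ {c, d, -a, -b} : Finset (ℂ × ℂ)).image fun x => x.1 - x.2)
  refine ⟨r, hr, fun p hp q hq hne => ?_⟩
  obtain ⟨e, he, n, rfl⟩ := mem_progression_of_mem_barnes hp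
  obtain ⟨f, hf, m, rfl⟩ := mem_progression_of_mem_barnes hq
  have h1 : 2 * Real.pi * I * (e + n) - 2 * Real.pi * I * (f + m) =
      2 * Real.pi * I * (e - f + (n - m : ℤ)) := by
    push_cast
    ring
  have h2 : e - f + ((n - m : ℤ) : ℂ) ≠ 0 := fun h0 => by
    rw [h0, mul_zero, sub_eq_zero] at h1
    exact hne h1
  have h3 := h (e - f) (Finset.mem_image.2 ⟨(e, f), Finset.mem_product.2 ⟨he, hf⟩, rfl⟩) _ h2
  have h4 : ‖(2 * Real.pi * I : ℂ)‖ = 2 * Real.pi := by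
    simp [abs_of_pos Real.pi_pos]
  rw [dist_eq_norm, h1, norm_mul, h4]
  nlinarith [Real.pi_gt_three]

theorem countable_barnes (a b c d : ℂ) : (barnesAbove c d ∪ barnesBelow a b).Countable := by
  have h : ∀ f : ℕ → ℂ, ({u : ℂ | ∃ k : ℕ, u = f k} : Set ℂ).Countable := by
    intro f
    refine (countable_range f).mono ?_
    rintro u ⟨k, rfl⟩
    exact ⟨k, rfl⟩
  exact ((h _).union (h _)).union ((h _).union (h _))

theorem exists_separates_barnes {a b c d : ℂ}
    (h : Disjoint (barnesAbove c d) (barnesBelow a b)) :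
    ∃ C : Contour, C.Separates (barnesAbove c d) (barnesBelow a b) := by
  have hP := poleFamilies_barnes h
  -- The poles occupy only countably many heights, so some horizontal line avoids them all.
  obtain ⟨y, hy⟩ := (((countable_barnes a b c d).image im).dense_compl ℝ).nonempty
  obtain ⟨r, hr, hd⟩ := exists_lt_dist_barnes a b c d
  refine ⟨⟨y, (hP.finite_lt y).toFinset, (hP.finite_gt y).toFinset, r⟩, h,
    fun p hp hpy => hy ⟨p, hp, hpy⟩, fun p => ?_, fun p => ?_, hr, hd⟩
  · simp
  · simp

theorem exists_isContourSystem (hN : N ≠ 0) (ω : ℂ) :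
    ∃ C : ℕ → ℂ → Contour, IsContourSystem N ω C := by
  classical
  have h : ∀ (j : ℕ) (z : ℂ), ∃ C : Contour,
      Disjoint (polesAbove N ω z) (polesBelow N ω j z) →
        C.Separates (polesAbove N ω z) (polesBelow N ω j z) := fun j z => by
    by_cases hd : Disjoint (polesAbove N ω z) (polesBelow N ω j z)
    · rw [polesAbove_eq hN, polesBelow_eq hN] at hd ⊢
      obtain ⟨C, hC⟩ := exists_separates_barnes hd
      exact ⟨C, fun _ => hC⟩
    · exact ⟨⟨0, ∅, ∅, 0⟩, fun h => absurd h hd⟩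
  choose C hC using h
  exact ⟨C, fun j _ z => hC j z⟩

/-! ### The nested integral -/

/-- The values of u at which poles of the next level collide belong to the second families of the
present level, which the contour avoids. -/
theorem disjoint_poles_of_mem_points {C : Contour} {ω z u : ℂ} {j : ℕ}
    (hC : C.Separates (polesAbove N ω z) (polesBelow N ω j z)) (hj : j + 2 < N)
    (hu : u ∈ C.points) : Disjoint (polesAbove N ω u) (polesBelow N ω (j + 1) u) := by
  have hu' := hC.notMem_of_mem_points hu
  refine disjoint_poles (by omega) (fun k hk => hu' (Or.inl (Or.inr ⟨k, hk⟩)))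
    fun k hk => hu' (Or.inr (Or.inr ⟨k, ?_⟩))
  rw [hk]
  push_cast
  ring

theorem disjoint_poles_zero (hN : 2 ≤ N) {ω θ : ℂ}
    (h : ∀ m : ℤ, θ - ω ≠ (2 * m + 1) * Real.pi * I) :
    Disjoint (polesAbove N ω θ) (polesBelow N ω 0 θ) := by
  refine disjoint_poles (by omega) (fun k hk => h (k - 1) ?_) fun k hk => h (-k) ?_
  · rw [hk]
    push_cast
    ring
  · rw [hk]
    push_cast
    ring

/-- The part of the integrand that depends on the rapidities of the levels below `j` only. -/
noncomputable def lowerFactor (N : ℕ) (ω : ℂ) (α : Fin N) (δ : Antiparticle N) (j : ℕ)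
    (z : ℕ → ℂ) : ℂ :=
  charge δ α * ∏ i ∈ Finset.range j,
    phiTilde N (z i - z (i + 1)) * levelWeight N ω α.val i (z i) (z (i + 1))

theorem lowerFactor_succ_update (ω : ℂ) (α : Fin N) (δ : Antiparticle N) (j : ℕ) (z : ℕ → ℂ)
    (u : ℂ) : lowerFactor N ω α δ (j + 1) (Function.update z (j + 1) u) =
      lowerFactor N ω α δ j z *
        (phiTilde N (z j - u) * levelWeight N ω α.val j (z j) u) := by
  unfold lowerFactor
  rw [Finset.prod_range_succ, Function.update_self,
    Function.update_of_ne (show j ≠ j + 1 by omega), Finset.prod_congr rfl fun i hi => by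
      have := Finset.mem_range.1 hi
      rw [Function.update_of_ne (show i ≠ j + 1 by omega),
        Function.update_of_ne (show i + 1 ≠ j + 1 by omega)], mul_assoc]

theorem Contour.integral_const_mul (C : Contour) (c : ℂ) (f : ℂ → ℂ) :
    C.integral (fun u => c * f u) = c * C.integral f := by
  unfold Contour.integral
  simp only [MeasureTheory.integral_const_mul, circleIntegral.integral_const_mul,
    ← Finset.mul_sum]
  ring

theorem Contour.Integrable.const_mul {C : Contour} {f : ℂ → ℂ} (hf : C.Integrable f) (c : ℂ) :
    C.Integrable fun u => c * f u :=
  ⟨hf.1.const_mul c, fun p hp => (hf.2 p hp).const_smul⟩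

variable {C : ℕ → ℂ → Contour} {ω : ℂ} {α : Fin N} {δ : Antiparticle N}

/-- Induction from the innermost level: the inner integral, times the untouched lower factors, is a
multiple of the next level's integrand. Disjointness is required only while an integration remains,
hence the condition k ≠ 0. -/
theorem nestedIntegral_eq (hN : 1 ≤ N) (hC : IsContourSystem N ω C) (k : ℕ) :
    ∀ (j : ℕ) (z : ℕ → ℂ), k + j + 1 = N →
      (k ≠ 0 → Disjoint (polesAbove N ω (z j)) (polesBelow N ω j (z j))) →
      nestedIntegral C (integrand N ω α δ) k j z = lowerFactor N ω α δ j z *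
        ((∏ i ∈ Finset.Ico j (N - 1), levelConst N α.val i) * chiLevel N j (ω - z j)) := by
  induction k with
  | zero =>
    intro j z hj _
    have hj' : j = N - 1 := by omega
    subst hj'
    unfold nestedIntegral lowerFactor
    rw [integrand_eq hN, chiTilde_eq_chiLevel hN, Finset.Ico_self, Finset.prod_empty, one_mul]
  | succ k ih =>
    intro j z hj hd
    have hS := hC j (by omega) (z j) (hd (Nat.succ_ne_zero k))
    obtain ⟨-, hintegrable⟩ := level_integral (a := α.val) (by omega) hS
    have hpt : ∀ u ∈ (C j (z j)).points,
        nestedIntegral C (integrand N ω α δ) k (j + 1) (Function.update z (j + 1) u) =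
          (lowerFactor N ω α δ j z * ∏ i ∈ Finset.Ico (j + 1) (N - 1), levelConst N α.val i) *
            levelIntegrand N ω α.val j (z j) u := by
      intro u hu
      rw [ih (j + 1) _ (by omega), lowerFactor_succ_update, Function.update_self]
      · unfold levelIntegrand
        ring
      · intro hk
        rw [Function.update_self]
        exact disjoint_poles_of_mem_points hS (by omega) hu
    unfold nestedIntegral
    rw [Contour.integral_congr hS.radius_pos.le hpt, Contour.integral_const_mul, hintegrable,
      Finset.prod_eq_prod_Ico_succ_bot (show j < N - 1 by omega)]
    ring

theorem nestedWellDefined (hN : 1 ≤ N) (hC : IsContourSystem N ω C) (k : ℕ) :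
    ∀ (j : ℕ) (z : ℕ → ℂ), k + j + 1 = N →
      (k ≠ 0 → Disjoint (polesAbove N ω (z j)) (polesBelow N ω j (z j))) →
      NestedWellDefined N ω C (integrand N ω α δ) k j z := by
  induction k with
  | zero => exact fun _ _ _ _ => trivial
  | succ k ih =>
    intro j z hj hd
    have hS := hC j (by omega) (z j) (hd (Nat.succ_ne_zero k))
    have hnext : ∀ u ∈ (C j (z j)).points, k ≠ 0 →
        Disjoint (polesAbove N ω (Function.update z (j + 1) u (j + 1)))
          (polesBelow N ω (j + 1) (Function.update z (j + 1) u (j + 1))) := by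
      intro u hu hk
      rw [Function.update_self]
      exact disjoint_poles_of_mem_points hS (by omega) hu
    refine ⟨hS, ?_, fun u hu => ih (j + 1) _ (by omega) (hnext u hu)⟩
    obtain ⟨hintegrable, -⟩ := level_integral (a := α.val) (by omega) hS
    refine (hintegrable.const_mul (lowerFactor N ω α δ j z *
      ∏ i ∈ Finset.Ico (j + 1) (N - 1), levelConst N α.val i)).congr hS.radius_pos.le
      fun u hu => ?_
    rw [nestedIntegral_eq hN hC k (j + 1) _ (by omega) (hnext u hu), lowerFactor_succ_update,
      Function.update_self]
    unfold levelIntegrand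
    ring

theorem kFunction_eq_zero (hN : 2 ≤ N) (hC : IsContourSystem N ω C) {θ : ℂ}
    (hθ : Disjoint (polesAbove N ω θ) (polesBelow N ω 0 θ)) : kFunction N C θ ω α δ = 0 := by
  unfold kFunction
  rw [nestedIntegral_eq (by omega) hC (N - 1) 0 _ (by omega) fun _ => hθ,
    Finset.prod_eq_prod_Ico_succ_bot (show 0 < N - 1 by omega), levelConst_zero]
  ring

end

end NestedBethe

theorem proposition1 (N : ℕ) (hN : 2 ≤ N) (ω : ℂ) :
    (∃ C : ℕ → ℂ → NestedBethe.Contour, NestedBethe.IsContourSystem N ω C) ∧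
    ∀ C : ℕ → ℂ → NestedBethe.Contour, NestedBethe.IsContourSystem N ω C →
      ∀ θ : ℂ, (∀ m : ℤ, θ - ω ≠ (2 * m + 1) * Real.pi * Complex.I) →
        ∀ (α : Fin N) (δ : NestedBethe.Antiparticle N),
          NestedBethe.NestedWellDefined N ω C (NestedBethe.integrand N ω α δ) (N - 1) 0
            (fun _ => θ) ∧
          NestedBethe.kFunction N C θ ω α δ = 0 := by
  refine ⟨NestedBethe.exists_isContourSystem (by omega) ω, fun C hC θ hθ α δ => ?_⟩
  have hd := NestedBethe.disjoint_poles_zero hN hθ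
  exact ⟨NestedBethe.nestedWellDefined (by omega) hC (N - 1) 0 _ (by omega) fun _ => hd,
    NestedBethe.kFunction_eq_zero hN hC hd⟩
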